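/- **Conventions.** Rings are unital, modules are left modules, $A^m$ consists of row vectors, and for sets $X\subseteq A$ and $Y$ in an $A$-module, $XY$ is the set of finite sums of elements $xy$ with $x\in X$, $y\in Y$. A *Sylvester matrix rank function* for a ring $A$ is an $\mathbb R_{\ge 0}$-valued function $\mathrm{rk}$ on rectangular matrices over $A$ with $\mathrm{rk}(0)=0$, $\mathrm{rk}(1_A)=1$, $\mathrm{rk}(PQ)\le\min(\mathrm{rk}(P),\mathrm{rk}(Q))$, $\mathrm{rk}\begin{pmatrix}P&0\\0&Q\end{pmatrix}=\mathrm{rk}(P)+\mathrm{rk}(Q)$ and $\mathrm{rk}\begin{pmatrix}P&C\\0&Q\end{pmatrix}\ge\mathrm{rk}(P)+\mathrm{rk}(Q)$. A *bivariant Sylvester module rank function* for $A$ is a $[0,+\infty]$-valued function $\dim(\mathcal M_1|\mathcal M_2)$ of pairs of $A$-modules $\mathcal M_1\subseteq\mathcal M_2$ such that, with $\dim(\mathcal M)=\dim(\mathcal M|\mathcal M)$: it is isomorphism invariant; $\dim(\{0\})=0$ and $\dim(A)=1$; $\dim(\mathcal M_1\oplus\mathcal M_1'|\mathcal M_2\oplus\mathcal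 M_2')=\dim(\mathcal M_1|\mathcal M_2)+\dim(\mathcal M_1'|\mathcal M_2')$; $\dim(\mathcal M_1|\mathcal M_2)$ is the supremum of $\dim(\mathcal M_1'|\mathcal M_2)$ over finitely generated $\mathcal M_1'\subseteq\mathcal M_1$; if $\mathcal M_1$ is finitely generated, it is the infimum of $\dim(\mathcal M_1|\mathcal M_2')$ over finitely generated $\mathcal M_2'$ with $\mathcal M_1\subseteq\mathcal M_2'\subseteq\mathcal M_2$; and $\dim(\mathcal M_2)=\dim(\mathcal M_1|\mathcal M_2)+\dim(\mathcal M_2/\mathcal M_1)$. The functions $\mathrm{rk}$ and $\dim(\cdot|\cdot)$ *correspond* to each other if $\mathrm{rk}(P)=\dim(A^nP|A^m)$ for all $P\in M_{n,m}(A)$; this is a bijection between the two kinds of functions. **Setting.** Let $S$ be a ring, $R\subseteq S$ a subring with $1_R=1_S$, $\mathrm{rk}$ a Sylvester matrix rank function for $R$, and $\dim(\cdot|\cdot)$ the corresponding bivariant Sylvester module rank function for $R$. For a finitely generated free $R$-module $\mathcal W\cong R^k$ write $\dim(\mathcal W)=k$. Let $\mathcal F$ be a collection of left $R$-submodules of $S$,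 $\hat{\mathcal F}$ the set of its nonzero elements, and $\mathcal U\subseteq S$ a multiplicative set (containing $1_S$) of nonzero non-zero-divisors $g$ of $S$ with $gR=Rg$. Assume: 1. ($\mathcal F$ is a finite approximation system) the elements of $\mathcal F$ are finitely generated free; $\mathcal F$ is closed under $\cap$ and $+$; if $\mathcal V\subseteq\mathcal W$ are in $\mathcal F$, then $\mathcal W=\mathcal V\oplus\mathcal V'$ for some $\mathcal V'\in\mathcal F$; every finitely generated left $R$-submodule of $S$ lies in some $\mathcal W\in\mathcal F$. 2. (right amenability) for every finite $V\subseteq S$ and $\varepsilon>0$ some $\mathcal W\in\hat{\mathcal F}$ is $(V,\varepsilon)$-invariant: $\dim(\tilde{\mathcal W})\le(1+\varepsilon)\dim(\mathcal W)$ for some $\tilde{\mathcal W}\in\mathcal F$ containing $\mathcal W+\mathcal WV$. 3. (normality) each $\mathcal W\in\mathcal F$ has an $R$-basis in $\mathcal U$; $Rg\in\mathcal F$ for $g\in\mathcal U$; if $g\in\mathcal U$, $\mathcal W\in\mathcal F$ and $\mathcal W\subseteq Sg$, then $\{x\in S:xg\in\mathcal W\}\in\mathcal F$. 4. ($\mathrm{rk}$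 is preserved) $\mathrm{rk}$ is invariant under the automorphism $\sigma_g$ of $R$ given by $ga=\sigma_g(a)g$, for every $g\in\mathcal U$. 5. (weak quasitiling property of $(\mathcal F,\mathcal U)$) call $\mathcal W\in\hat{\mathcal F}$ $(\mathcal V,\delta)$-invariant, for $\mathcal V\in\mathcal F$, if $\dim(\mathcal W+\mathcal W\mathcal V)\le(1+\delta)\dim(\mathcal W)$. For all $0<\varepsilon<1$ and $\mathcal V\in\hat{\mathcal F}$ there are $(\mathcal V,\varepsilon)$-invariant $\mathcal W_1,\dots,\mathcal W_n\in\hat{\mathcal F}$ such that for all $\delta>0$ and $\mathcal V'\in\hat{\mathcal F}$ there are a $(\mathcal V',\delta)$-invariant $\mathcal W\in\hat{\mathcal F}$, sets $C_1,\dots,C_n\subseteq\mathcal U\cap\mathcal W$ and $\mathcal W_{j,c}\in\mathcal F$ ($1\le j\le n$, $c\in C_j$) with: $\mathcal W_{j,c}\subseteq\mathcal W_j$ and $\dim(\mathcal W_{j,c})\ge(1-\varepsilon)\dim(\mathcal W_j)$; the $R$-modules $c\mathcal W_{j,c}$ are linearly independent; $\sum_{j}\sum_{c\in C_j}c\mathcal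 W_j\subseteq\mathcal W$ and $\dim\big(\sum_j\sum_{c\in C_j}c\mathcal W_j\big)\ge(1-\varepsilon)\dim(\mathcal W)$. **Definitions.** Write $\lim_{\mathcal W}\psi(\mathcal W)=L$ if for every neighbourhood $O$ of $L$ there are $\mathcal V\in\mathcal F$ and $\delta>0$ with $\psi(\mathcal W)\in O$ for all $(\mathcal V,\delta)$-invariant $\mathcal W\in\hat{\mathcal F}$. For $S$-modules $\mathcal N_1\subseteq\mathcal N_2$ with $\mathcal N_1$ finitely generated put $$\dim_{\mathcal F}(\mathcal N_1|\mathcal N_2)=\lim_{\mathcal W}\frac{\dim(\mathcal W\mathcal M_1|\mathcal N_2)}{\dim(\mathcal W)},$$ where $\mathcal M_1$ is any finitely generated $R$-submodule of $\mathcal N_1$ generating $\mathcal N_1$ as an $S$-module; for arbitrary $\mathcal N_1\subseteq\mathcal N_2$ let $\dim_{\mathcal F}(\mathcal N_1|\mathcal N_2)$ be the supremum of $\dim_{\mathcal F}(\mathcal N_1^\sharp|\mathcal N_2)$ over the finitely generated $S$-submodules $\mathcal N_1^\sharp$ of $\mathcal N_1$. For $P\in M_{n,m}(S)$ and $\mathcal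 W\in\hat{\mathcal F}$ choose $\tilde{\mathcal W}\in\hat{\mathcal F}$ containing all $\mathcal WP_{ij}$ and let $\mathrm{rk}_{\mathcal W}(P)=\mathrm{rk}(B)$, where $B$ is the matrix over $R$ of the map $\mathcal W^n\to\tilde{\mathcal W}^m$, $w\mapsto wP$, in $R$-bases. For an ultrafilter $\omega$ on $\hat{\mathcal F}$ that is non-principal (it contains the set of $(V,\varepsilon)$-invariant $\mathcal W$ for all finite $V\subseteq S$, $\varepsilon>0$) put $\mathrm{rk}_{\mathcal F}(P)=\lim_{\mathcal W\to\omega}\mathrm{rk}_{\mathcal W}(P)/\dim(\mathcal W)$. **Theorem.** Under these assumptions: (a) the limits defining $\dim_{\mathcal F}(\mathcal N_1|\mathcal N_2)$ for finitely generated $\mathcal N_1$ exist and do not depend on $\mathcal M_1$ (and the supremum gives the same value for such $\mathcal N_1$); (b) $\dim_{\mathcal F}(\cdot|\cdot)$ is a bivariant Sylvester module rank function for $S$; (c) for every non-principal ultrafilter $\omega$ on $\hat{\mathcal F}$, $\mathrm{rk}_{\mathcal F}$ is a Sylvester matrix rank function for $S$, it corresponds to $\dim_{\mathcal F}(\cdot|\cdot)$,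 i.e. $\mathrm{rk}_{\mathcal F}(P)=\dim_{\mathcal F}(S^nP|S^m)$ for all $P\in M_{n,m}(S)$, and $\dim_{\mathcal F}(\cdot|\cdot)$ is the only bivariant Sylvester module rank function for $S$ with this property; (d) moreover $\lim_{\mathcal W}\mathrm{rk}_{\mathcal W}(P)/\dim(\mathcal W)=\dim_{\mathcal F}(S^nP|S^m)$ for all $P\in M_{n,m}(S)$, so that $\mathrm{rk}_{\mathcal F}$ does not depend on $\omega$. -/

import Mathlib

open scoped ENNReal NNReal Topology

universe u

noncomputable section

namespace SylvesterRank

/-! ### Sylvester rank functions -/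

section RankFunctions

variable (A : Type u) [Ring A]

/-- A function on rectangular matrices over `A` with values in the nonnegative reals. -/
abbrev MatrixFun : Type u := ∀ ⦃n m : ℕ⦄, Matrix (Fin n) (Fin m) A → ℝ≥0

/-- An assignment `(M₁ ⊆ M₂) ↦ dim(M₁ | M₂) ∈ [0, +∞]` for left `A`-modules: `d M₂ M₁` stands for
`dim(M₁ | M₂)`, and `d M ⊤` for `dim(M) = dim(M | M)`. -/
abbrev BivariantFun : Type (u + 1) :=
  ∀ (M : Type u) [AddCommGroup M] [Module A M], Submodule A M → ℝ≥0∞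

variable {A}

/-- The block matrix with rows `[P, C]` and `[0, Q]`, indexed by `Fin`. -/
def blockUpper {n m k l : ℕ} (P : Matrix (Fin n) (Fin m) A) (C : Matrix (Fin n) (Fin l) A)
    (Q : Matrix (Fin k) (Fin l) A) : Matrix (Fin (n + k)) (Fin (m + l)) A :=
  Matrix.reindex finSumFinEquiv finSumFinEquiv (Matrix.fromBlocks P C 0 Q)

/-- Sylvester matrix rank functions. -/
structure IsSylvesterMatrixRank (rk : MatrixFun A) : Prop where
  zero : ∀ n m : ℕ, rk (0 : Matrix (Fin n) (Fin m) A) = 0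
  one : rk (1 : Matrix (Fin 1) (Fin 1) A) = 1
  mul_le : ∀ {n m l : ℕ} (P : Matrix (Fin n) (Fin m) A) (Q : Matrix (Fin m) (Fin l) A),
    rk (P * Q) ≤ min (rk P) (rk Q)
  diag : ∀ {n m k l : ℕ} (P : Matrix (Fin n) (Fin m) A) (Q : Matrix (Fin k) (Fin l) A),
    rk (blockUpper P 0 Q) = rk P + rk Q
  upper : ∀ {n m k l : ℕ} (P : Matrix (Fin n) (Fin m) A) (C : Matrix (Fin n) (Fin l) A)
    (Q : Matrix (Fin k) (Fin l) A), rk P + rk Q ≤ rk (blockUpper P C Q)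

/-- Bivariant Sylvester module rank functions. -/
structure IsBivariantRank (d : BivariantFun A) : Prop where
  iso : ∀ (M M' : Type u) [AddCommGroup M] [Module A M] [AddCommGroup M'] [Module A M']
    (e : M ≃ₗ[A] M') (P : Submodule A M), d M' (P.map (e : M →ₗ[A] M')) = d M P
  zero : d PUnit.{u + 1} ⊤ = 0
  one : d A ⊤ = 1
  prod : ∀ (M M' : Type u) [AddCommGroup M] [Module A M] [AddCommGroup M'] [Module A M']
    (P : Submodule A M) (P' : Submodule A M'), d (M × M') (P.prod P') = d M P + d M' P'
  sup : ∀ (M : Type u) [AddCommGroup M] [Module A M] (P : Submodule A M),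
    d M P = ⨆ (Q : Submodule A M) (_ : Q.FG) (_ : Q ≤ P), d M Q
  inf : ∀ (M : Type u) [AddCommGroup M] [Module A M] (P : Submodule A M), P.FG →
    d M P = ⨅ (Q : Submodule A M) (_ : Q.FG) (_ : P ≤ Q), d Q (P.submoduleOf Q)
  add : ∀ (M : Type u) [AddCommGroup M] [Module A M] (P : Submodule A M),
    d M ⊤ = d M P + d (M ⧸ P) ⊤

/-- The submodule `AⁿP` of the module `Aᵐ` of row vectors, for an `n × m` matrix `P`. -/
def rowModule {n m : ℕ} (P : Matrix (Fin n) (Fin m) A) : Submodule A (Fin m → A) :=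
  LinearMap.range (Matrix.vecMulLinear P)

/-- `d` and `rk` correspond to each other: `rk(P) = dim(AⁿP | Aᵐ)` for all matrices `P`. -/
def Corresponds (d : BivariantFun A) (rk : MatrixFun A) : Prop :=
  ∀ (n m : ℕ) (P : Matrix (Fin n) (Fin m) A), (rk P : ℝ≥0∞) = d (Fin m → A) (rowModule P)

/-- The bivariant Sylvester module rank function corresponding to a Sylvester matrix rank
function `rk` (definite description; every Sylvester matrix rank function has exactly one). -/
def bivariantOf (rk : MatrixFun A) : BivariantFun A :=
  Classical.epsilon fun d : BivariantFun A => IsBivariantRank d ∧ Corresponds d rk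

/-- The rank `n` of a finitely generated free left module `M ≅ Aⁿ`. (`Module.finrank` is a different
number for general rings with invariant basis number: it counts linearly independent vectors.) -/
def freeDim (A : Type u) [Ring A] (M : Type u) [AddCommGroup M] [Module A M] : ℕ :=
  sInf {n : ℕ | Nonempty (M ≃ₗ[A] (Fin n → A))}

end RankFunctions

/-! ### Amenable normal extensions -/

section Extensions

variable {S : Type u} [Ring S] {R : Subring S}

/-- `W 𝓜`: the finite sums of elements `w x` with `w ∈ W` and `x ∈ 𝓜`, for a left `R`-submodule `W`
of `S` and an `R`-submodule `𝓜` of a left `S`-module. -/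
def mulSub {N : Type u} [AddCommGroup N] [Module S N] (W : Submodule R S) (M : Submodule R N) :
    Submodule R N :=
  Submodule.span R {x : N | ∃ w ∈ W, ∃ y ∈ M, x = w • y}

/-- `g W`, for `g ∈ S` with `g R = R g`. -/
def leftTranslate (g : S) (W : Submodule R S) : Submodule R S :=
  Submodule.span R {x : S | ∃ w ∈ W, x = g * w}

/-- Finite approximation systems. -/
structure IsFiniteApproximationSystem (F : Set (Submodule R S)) : Prop where
  free : ∀ W ∈ F, Module.Finite R W ∧ Module.Free R W
  inf_mem : ∀ W ∈ F, ∀ V ∈ F, W ⊓ V ∈ F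
  sup_mem : ∀ W ∈ F, ∀ V ∈ F, W ⊔ V ∈ F
  compl : ∀ W ∈ F, ∀ V ∈ F, V ≤ W → ∃ V' ∈ F, Disjoint V V' ∧ V ⊔ V' = W
  exhaust : ∀ M : Submodule R S, M.FG → ∃ W ∈ F, M ≤ W

/-- `F̂`: the nonzero elements of `F`. -/
def nonzeroPart (F : Set (Submodule R S)) : Set (Submodule R S) := {W | W ∈ F ∧ W ≠ ⊥}

/-- `W` is `(V, ε)`-invariant, for a subset `V` of `S`. -/
def SetInvariant (F : Set (Submodule R S)) (V : Set S) (ε : ℝ) (W : Submodule R S) : Prop :=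
  ∃ W' ∈ F, W ≤ W' ∧ (∀ w ∈ W, ∀ v ∈ V, w * v ∈ W') ∧
    (freeDim R W' : ℝ) ≤ (1 + ε) * (freeDim R W : ℝ)

/-- The amenability condition for a finite approximation system. -/
def IsRightAmenable (F : Set (Submodule R S)) : Prop :=
  ∀ V : Set S, V.Finite → ∀ ε : ℝ, 0 < ε → ∃ W ∈ nonzeroPart F, SetInvariant F V ε W

/-- `N_S(R)`: the nonzero `g ∈ S` that are not zero-divisors and satisfy `g R = R g`. -/
def normalizers (R : Subring S) : Set S :=
  {g | g ≠ 0 ∧ (∀ b : S, g * b = 0 → b = 0) ∧ (∀ b : S, b * g = 0 → b = 0) ∧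
    (fun a : S => g * a) '' (R : Set S) = (fun a : S => a * g) '' (R : Set S)}

/-- The finite approximation system `F` is normal with respect to the multiplicative set `U`. -/
structure IsNormalSystem (F : Set (Submodule R S)) (U : Submonoid S) : Prop where
  subset : (U : Set S) ⊆ normalizers R
  basis : ∀ W ∈ F, ∃ (n : ℕ) (b : Module.Basis (Fin n) R W), ∀ i, (b i : S) ∈ U
  line_mem : ∀ g ∈ U, Submodule.span R {g} ∈ F
  div_mem : ∀ g ∈ U, ∀ W ∈ F, (∀ w ∈ W, ∃ s : S, w = s * g) →
    ∃ W' ∈ F, ∀ x : S, x ∈ W' ↔ x * g ∈ W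

/-- `rk` is invariant under `σ_g` for every `g ∈ U`, where `σ_g(a)` is the element of `R` with
`g a = σ_g(a) g`. -/
def PreservesRank (U : Submonoid S) (rk : MatrixFun R) : Prop :=
  ∀ g ∈ U, ∀ (n m : ℕ) (P Q : Matrix (Fin n) (Fin m) R),
    (∀ i j, g * (P i j : S) = (Q i j : S) * g) → rk Q = rk P

/-- `W` is `(V, δ)`-invariant, for `V ∈ F`: `dim(W + WV) ≤ (1 + δ) dim(W)`. -/
def Invariant (V : Submodule R S) (δ : ℝ) (W : Submodule R S) : Prop :=
  (freeDim R (W ⊔ mulSub W V : Submodule R S) : ℝ) ≤ (1 + δ) * (freeDim R W : ℝ)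

/-- `ψ(W)` converges to `L` when `W ∈ F̂` becomes more and more right invariant. -/
def FolnerTendsto {X : Type*} [TopologicalSpace X] (F : Set (Submodule R S))
    (ψ : Submodule R S → X) (L : X) : Prop :=
  ∀ O ∈ 𝓝 L, ∃ V ∈ F, ∃ δ : ℝ, 0 < δ ∧ ∀ W ∈ nonzeroPart F, Invariant V δ W → ψ W ∈ O

/-- `W` can be `ε`-quasitiled by `T 1, …, T n`. -/
def Quasitiled (F : Set (Submodule R S)) (U : Submonoid S) (ε : ℝ) {n : ℕ}
    (T : Fin n → Submodule R S) (W : Submodule R S) : Prop :=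
  ∃ (C : Fin n → Set S) (T' : ∀ j : Fin n, C j → Submodule R S),
    (∀ j, ∀ c ∈ C j, c ∈ U ∧ c ∈ W) ∧
    (∀ j c, T' j c ∈ F ∧ T' j c ≤ T j ∧
      (1 - ε) * (freeDim R (T j) : ℝ) ≤ (freeDim R (T' j c) : ℝ)) ∧
    iSupIndep (fun p : (Σ j : Fin n, C j) => leftTranslate (p.2 : S) (T' p.1 p.2)) ∧
    (⨆ (j : Fin n) (c : C j), leftTranslate (c : S) (T j)) ≤ W ∧
    (1 - ε) * (freeDim R W : ℝ) ≤
      (freeDim R (⨆ (j : Fin n) (c : C j), leftTranslate (c : S) (T j) : Submodule R S) : ℝ)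

/-- The weak quasitiling property of `(F, U)`. -/
def WeakQuasitiling (F : Set (Submodule R S)) (U : Submonoid S) : Prop :=
  ∀ ε : ℝ, 0 < ε → ε < 1 → ∀ V ∈ nonzeroPart F,
    ∃ (n : ℕ) (T : Fin n → Submodule R S),
      (∀ j, T j ∈ nonzeroPart F ∧ Invariant V ε (T j)) ∧
      ∀ δ : ℝ, 0 < δ → ∀ V' ∈ nonzeroPart F,
        ∃ W ∈ nonzeroPart F, Invariant V' δ W ∧ Quasitiled F U ε T W

/-! ### The matrix rank function on the extension -/

/-- `B` is the matrix over `R` of `Wⁿ → W'ᵐ`, `w ↦ w P`, in some `R`-bases of `Wⁿ` and `W'ᵐ`, where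
`W' ∈ F̂` contains all `W P i j`. -/
def IsMatrixOf (F : Set (Submodule R S)) (W : Submodule R S) {n m : ℕ}
    (P : Matrix (Fin n) (Fin m) S) {l p : ℕ} (B : Matrix (Fin l) (Fin p) R) : Prop :=
  ∃ W' ∈ nonzeroPart F, (∀ i j, ∀ w ∈ W, w * P i j ∈ W') ∧
    ∃ (b : Module.Basis (Fin l) R (Fin n → W)) (b' : Module.Basis (Fin p) R (Fin m → W')),
      ∀ (i : Fin l) (j : Fin m),
        ∑ k, (b i k : S) * P k j = ∑ q, (B i q : S) * (b' q j : S)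

/-- `rk_W(P) = rk(B)` for any matrix `B` as above (the set below is a singleton). -/
def rkOn (F : Set (Submodule R S)) (rk : MatrixFun R) (W : Submodule R S) {n m : ℕ}
    (P : Matrix (Fin n) (Fin m) S) : ℝ≥0 :=
  sInf {r : ℝ≥0 | ∃ (l p : ℕ) (B : Matrix (Fin l) (Fin p) R), IsMatrixOf F W P B ∧ r = rk B}

/-- An ultrafilter on `F̂` is non-principal if it contains, for all finite `V ⊆ S` and `ε > 0`, the
set of `(V, ε)`-invariant elements. -/
def NonPrincipal (F : Set (Submodule R S)) (ω : Ultrafilter (nonzeroPart F)) : Prop :=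
  ∀ V : Set S, V.Finite → ∀ ε : ℝ, 0 < ε →
    {W : nonzeroPart F | SetInvariant F V ε (W : Submodule R S)} ∈ ω

/-- `rk_F(P)`, the limit of `rk_W(P) / dim(W)` along the ultrafilter `ω` on `F̂`. -/
def rkExt (F : Set (Submodule R S)) (rk : MatrixFun R) (ω : Ultrafilter (nonzeroPart F)) :
    MatrixFun S := fun _ _ P =>
  Filter.limUnder (ω : Filter (nonzeroPart F)) fun W : nonzeroPart F =>
    rkOn F rk (W : Submodule R S) P / (freeDim R (W : Submodule R S) : ℝ≥0)

/-! ### The bivariant function on the extension -/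

/-- The function `W ↦ dim(W M₁ | N₂) / dim(W)`, for an `R`-submodule `M₁` of a left
`S`-module `N₂`. -/
def normalizedDim (rk : MatrixFun R) (N : Type u) [AddCommGroup N] [Module S N]
    (M : Submodule R N) (W : Submodule R S) : ℝ≥0∞ :=
  bivariantOf rk N (mulSub W M) / (freeDim R W : ℝ≥0∞)

/-- `dim_F(N₁ | N₂)` for finitely generated `N₁`: the limit of `dim(W M₁ | N₂) / dim(W)` as `W ∈ F̂`
becomes more and more right invariant, where `M₁` is any finitely generated `R`-submodule of `N₁`
that generates `N₁` as an `S`-module. -/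
def dimExtFG (F : Set (Submodule R S)) (rk : MatrixFun R) (N : Type u) [AddCommGroup N]
    [Module S N] (N₁ : Submodule S N) : ℝ≥0∞ :=
  Classical.epsilon fun L : ℝ≥0∞ => ∀ M₁ : Submodule R N, M₁.FG →
    Submodule.span S (M₁ : Set N) = N₁ → FolnerTendsto F (normalizedDim rk N M₁) L

/-- `dim_F(N₁ | N₂)`: the supremum of `dim_F(N₁' | N₂)` over the finitely generated
`S`-submodules `N₁'` of `N₁`. -/
def dimExt (F : Set (Submodule R S)) (rk : MatrixFun R) : BivariantFun S :=
  fun N _ _ N₁ => ⨆ (Q : Submodule S N) (_ : Q.FG) (_ : Q ≤ N₁), dimExtFG F rk N Q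

end Extensions

end SylvesterRank

end

open SylvesterRank

/-!
The strategy is to reduce everything to one estimate for strongly subadditive functions on `F`.

Over an arbitrary ring, a bivariant rank function is determined by its matrix rank function
(`IsBivariantRank.eq_of_corresponds`), and one exists for every matrix rank function `rk`. It is
constructed from presentations: `dim(X | M)` for finitely generated `X` is the infimum of
`rank(G + K) - rank(K)` over all linear maps `π` from a free module of finite rank to `M`, all `G`
with `X ⊆ π(G)` and all `K ⊆ ker π` (`bivariantDim`), where the rank of a submodule of a free module
is the supremum of the ranks of the matrices with rows in it. The axioms of bivariant rank functions
follow from a short list of inequalities between dimensions of finitely generated submodules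
(`IsRankSystem`). The same list is verified for `dim` over `R` and for `dim_F` over `S`, and it also
yields the axioms of matrix rank functions.

For the extension, fix an `S`-module `N` and a finitely generated `R`-submodule `M`. The function
`D(W) = dim(W M | N)` is monotone and strongly subadditive on the lattice `F`, and left
multiplication by `g ∈ U` does not increase it, because it is semilinear over an automorphism of `R`
that preserves `rk`. Suppose that `D(A) < l dim(A)` for some nonzero `A ∈ F`, and take `A` of least
dimension. Then `D(C) ≥ l dim(C)` for all `C ∈ F` of smaller dimension. If `g ∈ U` and `V ∈ F`, then
`D(V + g A) - D(V) ≤ D(g A) - D(g A ∩ V) ≤ l (dim(A) - dim(g A ∩ V)) = l (dim(V + g A) - dim(V))`,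
and by adding the submodules `g A`, one for each element `g` of a basis of `W` in `U`, one gets
`D(W A) ≤ l dim(W A)`. For sufficiently invariant `W` the modules `W` and `W A` differ by little, so
that `D(W) / dim(W)` is at most about `l`. Hence `D(W) / dim(W)` converges to its infimum over `F`
(`IsAmenableNormal.tendsto_normalizedDim`).

The argument is carried out modulo an `S`-submodule `P` of `N`, where finitely many elements of `P`
suffice: the bound holds for `dim` modulo `W Q`, for some finitely generated `R`-submodule `Q` of
`P` (`IsAmenableNormal.exists_eventually_relDim_le`). This gives the additivity of `dim_F`. The
continuity axiom for `dim_F` holds because limits that are infima commute with infima. Finally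
`rk_W(P)` is the dimension of `W M` in `Sᵐ`, where `M` is spanned by the rows of `P`, because a
member of `F` is a direct summand of every larger one. So the limit of `rk_W(P) / dim(W)` is
`dim_F(SⁿP | Sᵐ)`.
-/

noncomputable section

namespace SylvesterRank

/-! ### Reduction of the axioms to finitely generated submodules -/

section RankSystem

variable {A : Type u} [Ring A]

theorem le_add_of_forall_lt {x y c : ℝ≥0∞} (h : ∀ t, x < t → y ≤ t + c) : y ≤ x + c := by
  rcases eq_or_ne x ⊤ with rfl | hx
  · simp
  · refine ENNReal.le_of_forall_pos_le_add fun ε hε _ => ?_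
    have := h (x + ε) (ENNReal.lt_add_right hx (by simpa using hε.ne'))
    calc y ≤ x + ε + c := this
      _ = x + c + ε := by ring

theorem exists_fg_lift {M M' : Type u} [AddCommGroup M] [Module A M] [AddCommGroup M']
    [Module A M'] (f : M →ₗ[A] M') (P : Submodule A M) {Q : Submodule A M'} (hQ : Q.FG)
    (h : Q ≤ P.map f) : ∃ X : Submodule A M, X.FG ∧ X ≤ P ∧ X.map f = Q := by
  obtain ⟨n, s, rfl⟩ := Submodule.fg_iff_exists_fin_generating_family.1 hQ
  have hs : ∀ i, ∃ x ∈ P, f x = s i := fun i =>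
    h (Submodule.subset_span (Set.mem_range_self i))
  choose x hxP hx using hs
  refine ⟨Submodule.span A (Set.range x), Submodule.fg_span (Set.finite_range x), ?_, ?_⟩
  · rw [Submodule.span_le]
    rintro _ ⟨i, rfl⟩
    exact hxP i
  · rw [Submodule.map_span, ← Set.range_comp]
    congr 2
    exact funext hx

/-- A form of the axioms of bivariant rank functions in terms of finitely generated submodules and
inequalities. It implies `IsBivariantRank`, see `IsRankSystem.isBivariantRank`. The axiom `superadd`
gives one half of additivity. The axiom `approx` gives the other half: it says that the relations
`P` of a quotient `M ⧸ P` can be replaced by finitely many of them, at a small cost. -/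
structure IsRankSystem (d : BivariantFun A) : Prop where
  map_le_of_fg : ∀ {M M' : Type u} [AddCommGroup M] [Module A M] [AddCommGroup M'] [Module A M']
    (f : M →ₗ[A] M') (P : Submodule A M), P.FG → d M' (P.map f) ≤ d M P
  sup : ∀ (M : Type u) [AddCommGroup M] [Module A M] (P : Submodule A M),
    d M P = ⨆ (Q : Submodule A M) (_ : Q.FG) (_ : Q ≤ P), d M Q
  inf : ∀ (M : Type u) [AddCommGroup M] [Module A M] (P : Submodule A M), P.FG →
    d M P = ⨅ (Q : Submodule A M) (_ : Q.FG) (_ : P ≤ Q), d Q (P.submoduleOf Q)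
  one : d A ⊤ = 1
  superadd : ∀ {M : Type u} [AddCommGroup M] [Module A M] (P X C : Submodule A M),
    X.FG → C.FG → C ≤ P → d (M ⧸ P) (X.map P.mkQ) + d M C ≤ d M (X ⊔ C)
  approx : ∀ {M : Type u} [AddCommGroup M] [Module A M] (P X : Submodule A M), X.FG →
    ∀ t, d (M ⧸ P) (X.map P.mkQ) < t → ∃ C₀ : Submodule A M, C₀.FG ∧ C₀ ≤ P ∧
      ∀ C : Submodule A M, C.FG → C₀ ≤ C → C ≤ P → d M (X ⊔ C) ≤ t + d M C

namespace IsRankSystem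

variable {d : BivariantFun A}
variable {M M' : Type u} [AddCommGroup M] [Module A M] [AddCommGroup M'] [Module A M']

theorem mono (hd : IsRankSystem d) {P Q : Submodule A M} (h : P ≤ Q) : d M P ≤ d M Q := by
  rw [hd.sup M P, hd.sup M Q]
  exact iSup_mono fun X => iSup_mono fun hX => iSup_mono' fun hXP => ⟨hXP.trans h, le_rfl⟩

theorem le_of_forall_fg (hd : IsRankSystem d) {P : Submodule A M} {c : ℝ≥0∞}
    (h : ∀ Q : Submodule A M, Q.FG → Q ≤ P → d M Q ≤ c) : d M P ≤ c := by
  rw [hd.sup M P]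
  exact iSup_le fun Q => iSup_le fun hQ => iSup_le fun hQP => h Q hQ hQP

theorem map_le (hd : IsRankSystem d) (f : M →ₗ[A] M') (P : Submodule A M) :
    d M' (P.map f) ≤ d M P := by
  refine hd.le_of_forall_fg fun Q hQ hQP => ?_
  obtain ⟨X, hX, hXP, rfl⟩ := exists_fg_lift f P hQ hQP
  exact (hd.map_le_of_fg f X hX).trans (hd.mono hXP)

theorem map_equiv (hd : IsRankSystem d) (e : M ≃ₗ[A] M') (P : Submodule A M) :
    d M' (P.map (e : M →ₗ[A] M')) = d M P := by
  refine le_antisymm (hd.map_le _ _) ?_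
  have := hd.map_le (e.symm : M' →ₗ[A] M) (P.map (e : M →ₗ[A] M'))
  rw [← Submodule.map_comp] at this
  simpa using this

theorem top_equiv (hd : IsRankSystem d) (e : M ≃ₗ[A] M') : d M ⊤ = d M' ⊤ := by
  rw [← hd.map_equiv e ⊤, Submodule.map_top, LinearEquiv.range]

theorem bot (hd : IsRankSystem d) : d M ⊥ = 0 := by
  have h1 : d PUnit.{u + 1} ⊤ ≤ 1 := by
    have := hd.map_le (0 : A →ₗ[A] PUnit.{u + 1}) ⊤
    rwa [hd.one, Subsingleton.elim (Submodule.map _ _) ⊤] at this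
  have h2 : d M ⊥ ≤ 1 := by
    have := hd.map_le (0 : PUnit.{u + 1} →ₗ[A] M) ⊤
    simp only [Submodule.map_zero] at this
    exact this.trans h1
  have h3 := hd.superadd (⊥ : Submodule A M) ⊥ ⊥ Submodule.fg_bot Submodule.fg_bot le_rfl
  have h4 := hd.map_equiv (Submodule.quotEquivOfEqBot (⊥ : Submodule A M) rfl) ⊥
  rw [Submodule.map_bot] at h4
  rw [Submodule.map_bot, ← h4, sup_idem] at h3
  by_contra h
  have h5 : d M ⊥ < d M ⊥ + d M ⊥ :=
    ENNReal.lt_add_right (h2.trans_lt ENNReal.one_lt_top).ne h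
  exact absurd h3 (not_le.2 h5)

/-- Additivity relative to a finitely generated submodule. -/
theorem quot_add (hd : IsRankSystem d) {X C : Submodule A M} (hX : X.FG) (hC : C.FG) :
    d (M ⧸ C) (X.map C.mkQ) + d M C = d M (X ⊔ C) := by
  refine le_antisymm (hd.superadd C X C hX hC le_rfl) ?_
  refine le_add_of_forall_lt fun t ht => ?_
  obtain ⟨C₀, -, hC₀, h⟩ := hd.approx C X hX t ht
  exact h C hC hC₀ le_rfl

theorem sup_le (hd : IsRankSystem d) {X C : Submodule A M} (hX : X.FG) (hC : C.FG) :
    d M (X ⊔ C) ≤ d M X + d M C := by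
  rw [← hd.quot_add hX hC]
  gcongr
  exact hd.map_le _ _

theorem lt_top (hd : IsRankSystem d) {X : Submodule A M} (hX : X.FG) : d M X < ⊤ := by
  induction X, hX using Submodule.fg_induction with
  | singleton x =>
    refine lt_of_le_of_lt ?_ ENNReal.one_lt_top
    have := hd.map_le (LinearMap.toSpanSingleton A M x) ⊤
    rwa [hd.one, Submodule.map_top, LinearMap.range_toSpanSingleton] at this
  | sup X Y hX hY h1 h2 =>
    exact (hd.sup_le hX hY).trans_lt (ENNReal.add_lt_top.2 ⟨h1, h2⟩)

/-- The quotient by more relations has smaller dimension. -/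
theorem quot_anti (hd : IsRankSystem d) {P Q : Submodule A M} (h : P ≤ Q) (X : Submodule A M) :
    d (M ⧸ Q) (X.map Q.mkQ) ≤ d (M ⧸ P) (X.map P.mkQ) := by
  have := hd.map_le (Submodule.factor h) (X.map P.mkQ)
  rwa [← Submodule.map_comp, Submodule.factor_comp_mk] at this

/-- Strong subadditivity. -/
theorem submodular (hd : IsRankSystem d) {X Y Z : Submodule A M} (hX : X.FG) (hY : Y.FG)
    (hZ : Z.FG) (hZX : Z ≤ X) (hZY : Z ≤ Y) : d M (X ⊔ Y) + d M Z ≤ d M X + d M Y := by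
  have h1 := hd.quot_add hX hY
  have h2 := hd.quot_add hX hZ
  rw [sup_eq_left.2 hZX] at h2
  rw [← h1, ← h2]
  calc _ ≤ d (M ⧸ Z) (X.map Z.mkQ) + d M Y + d M Z := by
        gcongr
        exact hd.quot_anti hZY X
    _ = _ := by ring

/-- `≤` is subadditivity. For `≥`, the submodule `0 × M'` is used as the relations in
`IsRankSystem.superadd`. -/
theorem prod_eq (hd : IsRankSystem d) (P : Submodule A M) (P' : Submodule A M') :
    d (M × M') (P.prod P') = d M P + d M' P' := by
  refine le_antisymm ?_ ?_
  · refine hd.le_of_forall_fg fun Q hQ hQP => ?_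
    have h1 : (Q.map (LinearMap.fst A M M')).FG := hQ.map _
    have h2 : (Q.map (LinearMap.snd A M M')).FG := hQ.map _
    have h3 : Q ≤ (Q.map (LinearMap.fst A M M')).map (LinearMap.inl A M M') ⊔
        (Q.map (LinearMap.snd A M M')).map (LinearMap.inr A M M') := by
      rintro ⟨x, y⟩ h
      have : ((x, y) : M × M') = (x, 0) + (0, y) := by simp
      rw [this]
      exact Submodule.add_mem_sup ⟨x, ⟨_, h, rfl⟩, rfl⟩ ⟨y, ⟨_, h, rfl⟩, rfl⟩
    refine (hd.mono h3).trans ((hd.sup_le (h1.map _) (h2.map _)).trans ?_)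
    refine add_le_add ((hd.map_le _ _).trans (hd.mono ?_)) ((hd.map_le _ _).trans (hd.mono ?_))
    · rintro _ ⟨x, hx, rfl⟩
      exact (hQP hx).1
    · rintro _ ⟨x, hx, rfl⟩
      exact (hQP hx).2
  · rw [hd.sup M P, hd.sup M' P']
    have key : ∀ (Q : Submodule A M) (Q' : Submodule A M'), Q.FG → Q ≤ P → Q'.FG → Q' ≤ P' →
        d M Q + d M' Q' ≤ d (M × M') (P.prod P') := by
      intro Q Q' hQ hQP hQ' hQP'
      let K : Submodule A (M × M') := LinearMap.ker (LinearMap.fst A M M')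
      let X : Submodule A (M × M') := Q.map (LinearMap.inl A M M')
      let C : Submodule A (M × M') := Q'.map (LinearMap.inr A M M')
      have hCK : C ≤ K := by
        rintro _ ⟨y, -, rfl⟩
        simp [K]
      have h1 := hd.superadd K X C (hQ.map _) (hQ'.map _) hCK
      have h2 : d M Q ≤ d ((M × M') ⧸ K) (X.map K.mkQ) := by
        have := hd.map_le (K.liftQ (LinearMap.fst A M M') le_rfl) (X.map K.mkQ)
        rw [← Submodule.map_comp, Submodule.liftQ_mkQ, ← Submodule.map_comp,
          LinearMap.fst_comp_inl, Submodule.map_id] at this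
        exact this
      have h3 : d M' Q' ≤ d (M × M') C := by
        have := hd.map_le (LinearMap.snd A M M') C
        rw [← Submodule.map_comp, LinearMap.snd_comp_inr, Submodule.map_id] at this
        exact this
      refine (add_le_add h2 h3).trans (h1.trans (hd.mono (_root_.sup_le ?_ ?_)))
      · rintro _ ⟨x, hx, rfl⟩
        exact ⟨hQP hx, P'.zero_mem⟩
      · rintro _ ⟨x, hx, rfl⟩
        exact ⟨P.zero_mem, hQP' hx⟩
    simp only [iSup_and', iSup_subtype']
    have : Nonempty {Q : Submodule A M // Q.FG ∧ Q ≤ P} := ⟨⟨⊥, Submodule.fg_bot, bot_le⟩⟩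
    have : Nonempty {Q : Submodule A M' // Q.FG ∧ Q ≤ P'} := ⟨⟨⊥, Submodule.fg_bot, bot_le⟩⟩
    exact ENNReal.iSup_add_iSup_le fun Q Q' => key Q Q' Q.2.1 Q.2.2 Q'.2.1 Q'.2.2

theorem top_eq_add (hd : IsRankSystem d) (P : Submodule A M) :
    d M ⊤ = d M P + d (M ⧸ P) ⊤ := by
  refine le_antisymm ?_ ?_
  · refine hd.le_of_forall_fg fun X hX _ => ?_
    rw [add_comm]
    refine le_add_of_forall_lt fun t ht => ?_
    obtain ⟨C, hC, hCP, h⟩ := hd.approx P X hX t ((hd.mono _root_.le_top).trans_lt ht)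
    exact (hd.mono le_sup_left).trans ((h C hC le_rfl hCP).trans (by gcongr; exact hd.mono hCP))
  · rw [hd.sup M P, hd.sup _ (⊤ : Submodule A (M ⧸ P))]
    have key : ∀ (C : Submodule A M) (Q : Submodule A (M ⧸ P)), C.FG → C ≤ P → Q.FG →
        d M C + d (M ⧸ P) Q ≤ d M ⊤ := by
      intro C Q hC hCP hQ
      obtain ⟨X, hX, -, rfl⟩ := exists_fg_lift P.mkQ ⊤ hQ (by simp)
      rw [add_comm]
      exact (hd.superadd P X C hX hC hCP).trans (hd.mono _root_.le_top)
    simp only [iSup_and', iSup_subtype']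
    have : Nonempty {Q : Submodule A M // Q.FG ∧ Q ≤ P} := ⟨⟨⊥, Submodule.fg_bot, bot_le⟩⟩
    have : Nonempty {Q : Submodule A (M ⧸ P) // Q.FG ∧ Q ≤ ⊤} :=
      ⟨⟨⊥, Submodule.fg_bot, bot_le⟩⟩
    exact ENNReal.iSup_add_iSup_le fun Q Q' => key Q Q' Q.2.1 Q.2.2 Q'.2.1

/-- The quotient by `P` may be replaced by any module that `M` maps onto with kernel `P`. -/
theorem quot_eq_map (hd : IsRankSystem d) (f : M →ₗ[A] M')
    (hf : Function.Surjective f) {P : Submodule A M} (hP : LinearMap.ker f = P)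
    (X : Submodule A M) : d (M ⧸ P) (X.map P.mkQ) = d M' (X.map f) := by
  subst hP
  rw [← hd.map_equiv (f.quotKerEquivOfSurjective hf), ← Submodule.map_comp]
  rfl

theorem quot_bot (hd : IsRankSystem d) (X : Submodule A M) :
    d (M ⧸ (⊥ : Submodule A M)) (X.map (⊥ : Submodule A M).mkQ) = d M X := by
  rw [hd.quot_eq_map LinearMap.id Function.surjective_id LinearMap.ker_id, Submodule.map_id]

theorem iSup_le_mul (hd : IsRankSystem d) {n : ℕ} {X : Fin n → Submodule A M}
    (hX : ∀ i, (X i).FG) {c : ℝ≥0∞} (h : ∀ i, d M (X i) ≤ c) : d M (⨆ i, X i) ≤ n * c := by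
  have key : ∀ s : Finset (Fin n), (s.sup X).FG ∧ d M (s.sup X) ≤ s.card * c := by
    intro s
    induction s using Finset.cons_induction with
    | empty => simpa [hd.bot] using Submodule.fg_bot
    | cons a s ha ih =>
      rw [Finset.sup_cons]
      refine ⟨(hX a).sup ih.1, (hd.sup_le (hX a) ih.1).trans ?_⟩
      rw [Finset.card_cons, Nat.cast_add, Nat.cast_one, add_comm (s.card : ℝ≥0∞), add_mul, one_mul]
      exact add_le_add (h a) ih.2
  simpa [← Finset.sup_univ_eq_iSup] using (key Finset.univ).2

theorem isBivariantRank (hd : IsRankSystem d) : IsBivariantRank d where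
  iso _ _ _ _ _ _ e P := hd.map_equiv e P
  zero := by
    rw [Subsingleton.elim (⊤ : Submodule A PUnit.{u + 1}) ⊥]
    exact hd.bot
  one := hd.one
  prod _ _ _ _ _ _ P P' := hd.prod_eq P P'
  sup := hd.sup
  inf := hd.inf
  add _ _ _ P := hd.top_eq_add P

end IsRankSystem

/-! ### Matrices and submodules of free modules -/

theorem rowModule_fg {n m : ℕ} (P : Matrix (Fin n) (Fin m) A) : (rowModule P).FG := by
  rw [rowModule, range_vecMulLinear]
  exact Submodule.fg_span (Set.finite_range _)

theorem row_mem_rowModule {n m : ℕ} (P : Matrix (Fin n) (Fin m) A) (i : Fin n) :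
    P i ∈ rowModule P := by
  rw [rowModule, range_vecMulLinear]
  exact Submodule.subset_span ⟨i, rfl⟩

theorem rowModule_eq_span {n m : ℕ} (P : Matrix (Fin n) (Fin m) A) :
    rowModule P = Submodule.span A (Set.range P) :=
  range_vecMulLinear P

theorem exists_rowModule_eq {m : ℕ} {X : Submodule A (Fin m → A)} (hX : X.FG) :
    ∃ (n : ℕ) (P : Matrix (Fin n) (Fin m) A), rowModule P = X := by
  obtain ⟨n, s, rfl⟩ := Submodule.fg_iff_exists_fin_generating_family.1 hX
  exact ⟨n, s, rowModule_eq_span (A := A) s⟩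

theorem rowModule_one (m : ℕ) : rowModule (1 : Matrix (Fin m) (Fin m) A) = ⊤ := by
  rw [rowModule, LinearMap.range_eq_top]
  exact fun v => ⟨v, Matrix.vecMul_one v⟩

theorem rowModule_mul {n m l : ℕ} (P : Matrix (Fin n) (Fin m) A) (Q : Matrix (Fin m) (Fin l) A) :
    rowModule (P * Q) = (rowModule P).map (Matrix.vecMulLinear Q) := by
  rw [rowModule, rowModule, ← LinearMap.range_comp]
  congr 1
  exact LinearMap.ext fun v => (Matrix.vecMul_vecMul v P Q).symm

theorem rowModule_mul_le {n m l : ℕ} (P : Matrix (Fin n) (Fin m) A)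
    (Q : Matrix (Fin m) (Fin l) A) : rowModule (P * Q) ≤ rowModule Q := by
  rw [rowModule_mul]
  exact LinearMap.map_le_range

/-- The splitting `Aᵐ⁺ˡ = Aᵐ × Aˡ`. -/
def finProdEquiv (A : Type u) [Ring A] (m l : ℕ) :
    (Fin (m + l) → A) ≃ₗ[A] (Fin m → A) × (Fin l → A) :=
  (LinearEquiv.funCongrLeft A A finSumFinEquiv).trans (LinearEquiv.sumArrowLequivProdArrow _ _ A A)

theorem map_rowModule_blockUpper {n m k l : ℕ} (P : Matrix (Fin n) (Fin m) A)
    (C : Matrix (Fin n) (Fin l) A) (Q : Matrix (Fin k) (Fin l) A) :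
    (rowModule (blockUpper P C Q)).map
      (finProdEquiv A m l : (Fin (m + l) → A) →ₗ[A] (Fin m → A) × (Fin l → A)) =
    Submodule.span A (Set.range fun i => ((P i, C i) : (Fin m → A) × (Fin l → A))) ⊔
      (rowModule Q).map (LinearMap.inr A (Fin m → A) (Fin l → A)) := by
  rw [rowModule_eq_span, rowModule_eq_span, Submodule.map_span, Submodule.map_span,
    ← Submodule.span_union]
  have h1 : ∀ i, finProdEquiv A m l (blockUpper P C Q (finSumFinEquiv (Sum.inl i))) =
      (P i, C i) := fun i => by
    ext j <;> simp [finProdEquiv, blockUpper, LinearEquiv.funCongrLeft, LinearMap.funLeft]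
  have h2 : ∀ i, finProdEquiv A m l (blockUpper P C Q (finSumFinEquiv (Sum.inr i))) =
      (0, Q i) := fun i => by
    ext j <;> simp [finProdEquiv, blockUpper, LinearEquiv.funCongrLeft, LinearMap.funLeft]
  congr 1
  ext z
  constructor
  · rintro ⟨_, ⟨i, rfl⟩, rfl⟩
    obtain ⟨i | i, rfl⟩ := finSumFinEquiv.surjective i
    · exact Or.inl ⟨i, (h1 i).symm⟩
    · exact Or.inr ⟨Q i, ⟨i, rfl⟩, (h2 i).symm⟩
  · rintro (⟨i, rfl⟩ | ⟨_, ⟨i, rfl⟩, rfl⟩)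
    · exact ⟨_, ⟨_, rfl⟩, h1 i⟩
    · exact ⟨_, ⟨_, rfl⟩, h2 i⟩

theorem IsRankSystem.isSylvesterMatrixRank {d : BivariantFun A} (hd : IsRankSystem d)
    {rk : MatrixFun A} (h : Corresponds d rk) : IsSylvesterMatrixRank rk where
  zero n m := by
    have := h n m 0
    rw [show rowModule (0 : Matrix (Fin n) (Fin m) A) = ⊥ from ?_, hd.bot] at this
    · exact_mod_cast this
    · rw [rowModule_eq_span, Submodule.span_eq_bot]
      rintro _ ⟨i, rfl⟩
      rfl
  one := by
    have := h 1 1 1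
    rw [rowModule_one, hd.top_equiv (LinearEquiv.funUnique (Fin 1) A A), hd.one] at this
    exact_mod_cast this
  mul_le {n m l} P Q := by
    refine le_min ?_ ?_ <;> rw [← ENNReal.coe_le_coe, h, h]
    · rw [rowModule_mul]
      exact hd.map_le _ _
    · exact hd.mono (rowModule_mul_le P Q)
  diag {n m k l} P Q := by
    rw [← ENNReal.coe_inj, ENNReal.coe_add, h, h, h, ← hd.prod_eq,
      ← hd.map_equiv (finProdEquiv A m l), map_rowModule_blockUpper]
    congr 1
    have : (Set.range fun i =>
        ((P i, (0 : Matrix (Fin n) (Fin l) A) i) : (Fin m → A) × (Fin l → A))) =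
        LinearMap.inl A (Fin m → A) (Fin l → A) '' Set.range P := by
      ext z
      constructor
      · rintro ⟨i, rfl⟩
        exact ⟨P i, ⟨i, rfl⟩, rfl⟩
      · rintro ⟨_, ⟨i, rfl⟩, rfl⟩
        exact ⟨i, rfl⟩
    rw [this, ← Submodule.map_span, ← rowModule_eq_span, Submodule.map_inl, Submodule.map_inr,
      Submodule.prod_sup_prod, sup_bot_eq, bot_sup_eq]
  upper {n m k l} P C Q := by
    rw [← ENNReal.coe_le_coe, ENNReal.coe_add, h, h, h, ← hd.map_equiv (finProdEquiv A m l),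
      map_rowModule_blockUpper]
    set X := Submodule.span A (Set.range fun i => ((P i, C i) : (Fin m → A) × (Fin l → A)))
    set Y := (rowModule Q).map (LinearMap.inr A (Fin m → A) (Fin l → A))
    let K : Submodule A ((Fin m → A) × (Fin l → A)) := LinearMap.ker (LinearMap.fst A _ _)
    have hYK : Y ≤ K := by
      rintro _ ⟨y, -, rfl⟩
      simp [K]
    have h1 := hd.superadd K X Y (Submodule.fg_span (Set.finite_range _))
      ((rowModule_fg Q).map _) hYK
    refine le_trans (add_le_add ?_ ?_) h1
    · have := hd.map_le (K.liftQ (LinearMap.fst A _ _) le_rfl) (X.map K.mkQ)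
      rw [← Submodule.map_comp, Submodule.liftQ_mkQ, Submodule.map_span, ← Set.range_comp] at this
      rw [rowModule_eq_span]
      exact this
    · have := hd.map_le (LinearMap.snd A (Fin m → A) (Fin l → A)) Y
      rwa [← Submodule.map_comp, LinearMap.snd_comp_inr, Submodule.map_id] at this

/-! ### Uniqueness of the bivariant rank function -/

section Unique

variable {d d' : BivariantFun A}

theorem IsBivariantRank.congr_free {rk : MatrixFun A} (hd : IsBivariantRank d)
    (hd' : IsBivariantRank d') (h : Corresponds d rk) (h' : Corresponds d' rk) {m : ℕ}
    (K : Submodule A (Fin m → A)) : d (Fin m → A) K = d' (Fin m → A) K := by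
  rw [hd.sup _ K, hd'.sup _ K]
  refine iSup_congr fun Q => iSup_congr fun hQ => iSup_congr fun _ => ?_
  obtain ⟨n, P, rfl⟩ := exists_rowModule_eq hQ
  rw [← h, ← h']

theorem Corresponds.free_ne_top {rk : MatrixFun A} (h : Corresponds d rk) (m : ℕ) :
    d (Fin m → A) ⊤ ≠ ⊤ := by
  rw [← rowModule_one, ← h]
  exact ENNReal.coe_ne_top

theorem IsBivariantRank.top_eq {M : Type u} [AddCommGroup M] [Module A M] (hd : IsBivariantRank d)
    {m : ℕ} (f : (Fin m → A) →ₗ[A] M) (hf : Function.Surjective f) :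
    d (Fin m → A) ⊤ = d (Fin m → A) (LinearMap.ker f) + d M ⊤ := by
  rw [hd.add _ (LinearMap.ker f), ← hd.iso _ _ (f.quotKerEquivOfSurjective hf) ⊤,
    Submodule.map_top, LinearEquiv.range]

theorem IsBivariantRank.congr_top {rk : MatrixFun A} (hd : IsBivariantRank d)
    (hd' : IsBivariantRank d') (h : Corresponds d rk) (h' : Corresponds d' rk)
    (M : Type u) [AddCommGroup M] [Module A M] [Module.Finite A M] :
    d M ⊤ = d' M ⊤ ∧ d M ⊤ ≠ ⊤ := by
  obtain ⟨m, f, hf⟩ := Module.Finite.exists_fin' A M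
  have h1 := hd.top_eq f hf
  have h2 := hd'.top_eq f hf
  have h3 := h.free_ne_top m
  rw [h1] at h3
  rw [← hd.congr_free hd' h h', ← hd.congr_free hd' h h', h1] at h2
  rw [ENNReal.add_ne_top] at h3
  exact ⟨(ENNReal.add_right_inj h3.1).1 h2, h3.2⟩

/-- A bivariant rank function is determined by the corresponding matrix rank function. -/
theorem IsBivariantRank.eq_of_corresponds {rk : MatrixFun A} (hd : IsBivariantRank d)
    (hd' : IsBivariantRank d') (h : Corresponds d rk) (h' : Corresponds d' rk) : d = d' := by
  have key : ∀ (M : Type u) [AddCommGroup M] [Module A M] [Module.Finite A M]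
      (P : Submodule A M), d M P = d' M P := by
    intro M _ _ _ P
    have h1 := hd.add M P
    have h2 := hd'.add M P
    obtain ⟨h3, h4⟩ := hd.congr_top hd' h h' (M ⧸ P)
    rw [← (hd.congr_top hd' h h' M).1, h1, ← h3] at h2
    exact (ENNReal.add_left_inj h4).1 h2
  funext M _ _ P
  rw [hd.sup M P, hd'.sup M P]
  refine iSup_congr fun Q => iSup_congr fun hQ => iSup_congr fun _ => ?_
  rw [hd.inf M Q hQ, hd'.inf M Q hQ]
  refine iInf_congr fun X => iInf_congr fun hX => iInf_congr fun _ => ?_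
  have : Module.Finite A X := Module.Finite.iff_fg.2 hX
  exact key X _

end Unique

end RankSystem

/-! ### Matrix rank functions as ranks of submodules of free modules -/

section MatrixRank

variable {A : Type u} [Ring A] {rk : MatrixFun A}

theorem IsSylvesterMatrixRank.add_le (hrk : IsSylvesterMatrixRank rk) {n m : ℕ}
    (P Q : Matrix (Fin n) (Fin m) A) : rk (P + Q) ≤ rk P + rk Q := by
  let E : Matrix (Fin n) (Fin (n + n)) A :=
    Matrix.reindex (Equiv.refl _) finSumFinEquiv (Matrix.fromCols 1 1)
  let G : Matrix (Fin (m + m)) (Fin m) A :=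
    Matrix.reindex finSumFinEquiv (Equiv.refl _) (Matrix.fromRows 1 1)
  have h : P + Q = E * blockUpper P 0 Q * G := by
    simp only [E, G, blockUpper, Matrix.reindex_apply, Matrix.submatrix_mul_equiv,
      Matrix.fromCols_mul_fromBlocks, Matrix.fromCols_mul_fromRows]
    simp
  rw [h, ← hrk.diag P Q]
  exact (hrk.mul_le _ _).trans ((min_le_left _ _).trans ((hrk.mul_le _ _).trans (min_le_right _ _)))

theorem IsSylvesterMatrixRank.one_eq (hrk : IsSylvesterMatrixRank rk) (n : ℕ) :
    rk (1 : Matrix (Fin n) (Fin n) A) = n := by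
  induction n with
  | zero => simpa [Subsingleton.elim (1 : Matrix (Fin 0) (Fin 0) A) 0] using hrk.zero 0 0
  | succ n ih =>
    have h : (1 : Matrix (Fin (n + 1)) (Fin (n + 1)) A) = blockUpper 1 0 1 := by
      simp [blockUpper, Matrix.fromBlocks_one]
    rw [h, hrk.diag, ih, hrk.one]
    simp

/-- The rank of a submodule `X` of a module `L`: the supremum of the ranks of the matrices whose
rows are images of elements of `X` under one linear map from `L` to a free module. If `L = Aᵐ` and
`X = AⁿP`, this is `rk P`; see `freeRank_rowModule`. -/
def freeRank (rk : MatrixFun A) {L : Type*} [AddCommGroup L] [Module A L] (X : Submodule A L) :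
    ℝ≥0∞ :=
  ⨆ t : {t : Σ n m : ℕ, (L →ₗ[A] Fin m → A) × (Fin n → L) // ∀ i, t.2.2.2 i ∈ X},
    (rk (Matrix.of fun i => t.1.2.2.1 (t.1.2.2.2 i)) : ℝ≥0∞)

section

variable {L L' : Type*} [AddCommGroup L] [Module A L] [AddCommGroup L'] [Module A L']

theorem le_freeRank {X : Submodule A L} {n m : ℕ} (φ : L →ₗ[A] Fin m → A) (x : Fin n → L)
    (hx : ∀ i, x i ∈ X) : (rk (Matrix.of fun i => φ (x i)) : ℝ≥0∞) ≤ freeRank rk X :=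
  le_iSup (fun t : {t : Σ n m : ℕ, (L →ₗ[A] Fin m → A) × (Fin n → L) // ∀ i, t.2.2.2 i ∈ X} =>
    (rk (Matrix.of fun i => t.1.2.2.1 (t.1.2.2.2 i)) : ℝ≥0∞)) ⟨⟨n, m, φ, x⟩, hx⟩

theorem freeRank_le {X : Submodule A L} {c : ℝ≥0∞}
    (h : ∀ (n m : ℕ) (φ : L →ₗ[A] Fin m → A) (x : Fin n → L), (∀ i, x i ∈ X) →
      (rk (Matrix.of fun i => φ (x i)) : ℝ≥0∞) ≤ c) : freeRank rk X ≤ c :=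
  iSup_le fun t => h _ _ _ _ t.2

theorem lt_freeRank {X : Submodule A L} {c : ℝ≥0∞} (h : c < freeRank rk X) :
    ∃ (n m : ℕ) (φ : L →ₗ[A] Fin m → A) (x : Fin n → L), (∀ i, x i ∈ X) ∧
      c < rk (Matrix.of fun i => φ (x i)) := by
  obtain ⟨t, ht⟩ := lt_iSup_iff.1 h
  exact ⟨_, _, _, _, t.2, ht⟩

theorem freeRank_mono {X Y : Submodule A L} (h : X ≤ Y) : freeRank rk X ≤ freeRank rk Y :=
  freeRank_le fun _ _ φ x hx => le_freeRank φ x fun i => h (hx i)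

theorem freeRank_map_le (f : L →ₗ[A] L') (X : Submodule A L) :
    freeRank rk (X.map f) ≤ freeRank rk X := by
  refine freeRank_le fun n m φ x hx => ?_
  choose y hy hyx using hx
  obtain rfl : (fun i => f (y i)) = x := funext hyx
  exact le_freeRank (φ ∘ₗ f) y hy

theorem freeRank_sup_le (hrk : IsSylvesterMatrixRank rk) (X Y : Submodule A L) :
    freeRank rk (X ⊔ Y) ≤ freeRank rk X + freeRank rk Y := by
  refine freeRank_le fun n m φ x hx => ?_
  choose y hy z hz hyz using fun i => Submodule.mem_sup.1 (hx i)
  have h : (Matrix.of fun i => φ (x i)) =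
      (Matrix.of fun i => φ (y i)) + Matrix.of fun i => φ (z i) := by
    ext i j
    simp [← hyz i]
  rw [h]
  refine le_trans ?_ (add_le_add (le_freeRank φ y hy) (le_freeRank φ z hz))
  exact_mod_cast hrk.add_le _ _

/-- The axiom on block upper triangular matrices, in terms of submodules. -/
theorem freeRank_add_map_le (hrk : IsSylvesterMatrixRank rk) (f : L →ₗ[A] L')
    {Y Z : Submodule A L} (hYZ : Y ≤ Z) (hY : Y ≤ LinearMap.ker f) :
    freeRank rk Y + freeRank rk (Z.map f) ≤ freeRank rk Z := by
  unfold freeRank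
  have : Nonempty {t : Σ n m : ℕ, (L →ₗ[A] Fin m → A) × (Fin n → L) // ∀ i, t.2.2.2 i ∈ Y} :=
    ⟨⟨⟨0, 0, 0, 0⟩, fun i => Y.zero_mem⟩⟩
  have : Nonempty {t : Σ n m : ℕ, (L' →ₗ[A] Fin m → A) × (Fin n → L') //
      ∀ i, t.2.2.2 i ∈ Z.map f} := ⟨⟨⟨0, 0, 0, 0⟩, fun i => Submodule.zero_mem _⟩⟩
  refine ENNReal.iSup_add_iSup_le ?_
  rintro ⟨⟨n, m, φ, y⟩, hy⟩ ⟨⟨k, l, ψ, w⟩, hw⟩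
  replace hy : ∀ i, y i ∈ Y := hy
  have hw' : ∀ i, w i ∈ Z.map f := hw
  choose z hz hzw using hw'
  dsimp only
  let Φ : L →ₗ[A] Fin (l + m) → A :=
    ((finProdEquiv A l m).symm : _ →ₗ[A] _) ∘ₗ LinearMap.prod (ψ ∘ₗ f) φ
  let v : Fin (k + n) → L := fun i => Sum.elim z y (finSumFinEquiv.symm i)
  have hΦ : (Matrix.of fun i => Φ (v i)) = blockUpper (Matrix.of fun i => ψ (w i))
      (Matrix.of fun i => φ (z i)) (Matrix.of fun i => φ (y i)) := by
    have hf : ∀ i, f (y i) = 0 := fun i => hY (hy i)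
    have hP : ∀ (p : (Fin l → A) × (Fin m → A)) (j : Fin l ⊕ Fin m),
        (finProdEquiv A l m).symm p (finSumFinEquiv j) = Sum.elim p.1 p.2 j := by
      rintro ⟨p, q⟩ (j | j)
      · simp [finProdEquiv, LinearEquiv.funCongrLeft, LinearMap.funLeft]
      · simp [finProdEquiv, LinearEquiv.funCongrLeft, LinearMap.funLeft]
    ext i j
    obtain ⟨i, rfl⟩ := finSumFinEquiv.surjective i
    obtain ⟨j, rfl⟩ := finSumFinEquiv.surjective j
    simp only [Matrix.of_apply, Φ, v, LinearMap.comp_apply, LinearEquiv.coe_coe, hP]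
    rcases i with i | i <;> rcases j with j | j <;> simp [blockUpper, hf, hzw]
  rw [add_comm]
  refine le_trans ?_ (le_freeRank Φ v ?_)
  · rw [hΦ]
    have := hrk.upper (Matrix.of fun i => ψ (w i)) (Matrix.of fun i => φ (z i))
      (Matrix.of fun i => φ (y i))
    exact_mod_cast this
  · intro i
    simp only [v]
    rcases finSumFinEquiv.symm i with i | i
    · exact hz i
    · exact hYZ (hy i)

theorem of_map_eq_mul {k m n : ℕ} (φ : (Fin k → A) →ₗ[A] Fin m → A) (x : Fin n → Fin k → A) :
    (Matrix.of fun i => φ (x i)) =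
      Matrix.of x * (Matrix.of fun j => φ (Pi.single j 1) : Matrix (Fin k) (Fin m) A) := by
  ext i j
  rw [Matrix.of_apply, Matrix.mul_apply, LinearMap.pi_apply_eq_sum_univ φ (x i),
    Finset.sum_apply]
  simp only [Pi.smul_apply, smul_eq_mul, Matrix.of_apply]
  refine Finset.sum_congr rfl fun l _ => ?_
  have h : (fun j => if l = j then 1 else 0) = (Pi.single l 1 : Fin k → A) := by
    ext a
    simp [Pi.single_apply, eq_comm]
  rw [h]

theorem freeRank_rowModule (hrk : IsSylvesterMatrixRank rk) {n m : ℕ}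
    (P : Matrix (Fin n) (Fin m) A) : freeRank rk (rowModule P) = rk P := by
  refine le_antisymm (freeRank_le fun k l φ x hx => ?_)
    (le_freeRank LinearMap.id (fun i => P i) (row_mem_rowModule P))
  choose y hy using hx
  have : Matrix.of x = Matrix.of y * P := by
    ext i j
    rw [Matrix.of_apply, ← hy i]
    rfl
  rw [of_map_eq_mul, this]
  have h1 := (hrk.mul_le (Matrix.of y * P)
    (Matrix.of fun j => φ (Pi.single j 1) : Matrix (Fin m) (Fin l) A)).trans (min_le_left _ _)
  exact_mod_cast h1.trans ((hrk.mul_le (Matrix.of y) P).trans (min_le_right _ _))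

theorem freeRank_ne_top (hrk : IsSylvesterMatrixRank rk) {m : ℕ}
    (X : Submodule A (Fin m → A)) : freeRank rk X ≠ ⊤ := by
  refine ne_top_of_le_ne_top ?_ (freeRank_mono (_root_.le_top : X ≤ ⊤))
  rw [← rowModule_one, freeRank_rowModule hrk]
  exact ENNReal.coe_ne_top

end

/-! ### The bivariant rank function of a matrix rank function -/

/-- The condition that `dim (X | M) ≤ r` is witnessed by a presentation: a linear map `π` from a
free module of finite rank `k` to `M`, a submodule `G` whose image contains `X`, and relations
`K ⊆ ker π` such that `G + K` has rank at most `r` over `K`. -/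
def HasPresentation (rk : MatrixFun A) {M : Type u} [AddCommGroup M] [Module A M]
    (X : Submodule A M) (r : ℝ≥0∞) : Prop :=
  ∃ (k : ℕ) (π : (Fin k → A) →ₗ[A] M) (G K : Submodule A (Fin k → A)),
    X ≤ G.map π ∧ K ≤ LinearMap.ker π ∧ freeRank rk (G ⊔ K) ≤ r + freeRank rk K

/-- The value of the bivariant rank function at a finitely generated submodule: the least relative
rank over all presentations. -/
def presDim (rk : MatrixFun A) {M : Type u} [AddCommGroup M] [Module A M]
    (X : Submodule A M) : ℝ≥0∞ :=
  sInf {r | HasPresentation rk X r}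

/-- The bivariant rank function of `rk`. -/
def bivariantDim (rk : MatrixFun A) : BivariantFun A := fun M _ _ P =>
  ⨆ (Q : Submodule A M) (_ : Q.FG) (_ : Q ≤ P), presDim rk Q

section

variable {M M' : Type u} [AddCommGroup M] [Module A M] [AddCommGroup M'] [Module A M']

theorem HasPresentation.presDim_le {X : Submodule A M} {r : ℝ≥0∞} (h : HasPresentation rk X r) :
    presDim rk X ≤ r := sInf_le h

theorem le_presDim {X : Submodule A M} {c : ℝ≥0∞} (h : ∀ r, HasPresentation rk X r → c ≤ r) :
    c ≤ presDim rk X := le_sInf h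

theorem presDim_mono {X Y : Submodule A M} (h : X ≤ Y) : presDim rk X ≤ presDim rk Y :=
  le_presDim fun _ ⟨k, π, G, K, h1, h2, h3⟩ =>
    HasPresentation.presDim_le ⟨k, π, G, K, h.trans h1, h2, h3⟩

theorem bivariantDim_of_fg {X : Submodule A M} (hX : X.FG) :
    bivariantDim rk M X = presDim rk X :=
  le_antisymm (iSup_le fun _ => iSup_le fun _ => iSup_le fun h => presDim_mono h)
    (le_iSup_of_le X (le_iSup_of_le hX (le_iSup_of_le le_rfl le_rfl)))

/-- Presentations over any free module of finite rank may be used. -/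
theorem presDim_le_of_free {L : Type*} [AddCommGroup L] [Module A L] {k : ℕ}
    (e : L ≃ₗ[A] (Fin k → A)) (π : L →ₗ[A] M) (G K : Submodule A L) {X : Submodule A M}
    {r : ℝ≥0∞} (h1 : X ≤ G.map π) (h2 : K ≤ LinearMap.ker π)
    (h3 : freeRank rk (G ⊔ K) ≤ r + freeRank rk K) : presDim rk X ≤ r := by
  refine HasPresentation.presDim_le ⟨k, π ∘ₗ (e.symm : (Fin k → A) →ₗ[A] L),
    G.map (e : L →ₗ[A] (Fin k → A)), K.map (e : L →ₗ[A] (Fin k → A)), ?_, ?_, ?_⟩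
  · rw [← Submodule.map_comp]
    convert h1
    ext x
    simp
  · rintro _ ⟨x, hx, rfl⟩
    simpa using h2 hx
  · rw [← Submodule.map_sup]
    refine (freeRank_map_le _ _).trans (h3.trans ?_)
    gcongr
    have := freeRank_map_le (rk := rk) (e.symm : (Fin k → A) →ₗ[A] L)
      (K.map (e : L →ₗ[A] (Fin k → A)))
    rw [← Submodule.map_comp] at this
    simpa using this

theorem presDim_map_le (f : M →ₗ[A] M') (X : Submodule A M) :
    presDim rk (X.map f) ≤ presDim rk X := by
  refine le_presDim fun r ⟨k, π, G, K, h1, h2, h3⟩ => ?_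
  refine HasPresentation.presDim_le ⟨k, f ∘ₗ π, G, K, ?_, ?_, h3⟩
  · rw [Submodule.map_comp]
    exact Submodule.map_mono h1
  · exact h2.trans (LinearMap.ker_le_ker_comp _ _)

theorem presDim_inf (X : Submodule A M) :
    presDim rk X = ⨅ (Q : Submodule A M) (_ : Q.FG) (_ : X ≤ Q), presDim rk (X.submoduleOf Q) := by
  refine le_antisymm ?_ ?_
  · refine le_iInf fun Q => le_iInf fun _ => le_iInf fun hXQ => ?_
    have := presDim_map_le (rk := rk) Q.subtype (X.submoduleOf Q)
    rwa [Submodule.submoduleOf, Submodule.map_comap_subtype, inf_eq_right.2 hXQ] at this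
  · refine le_presDim fun r ⟨k, π, G, K, h1, h2, h3⟩ => ?_
    have hX : X ≤ LinearMap.range π := h1.trans LinearMap.map_le_range
    have hfg : (LinearMap.range π).FG := by
      rw [← Submodule.map_top]
      exact Module.Finite.fg_top.map π
    refine iInf_le_of_le (LinearMap.range π) (iInf_le_of_le hfg (iInf_le_of_le hX ?_))
    refine HasPresentation.presDim_le ⟨k, π.rangeRestrict, G, K, ?_, ?_, h3⟩
    · rintro ⟨y, hy⟩ hyX
      obtain ⟨x, hx, rfl⟩ := h1 hyX
      exact ⟨x, hx, rfl⟩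
    · rwa [LinearMap.ker_rangeRestrict]

/-- A presentation of `X + C` in `M` splits into one of `C` in `M` and one of the image of `X` in
`M ⧸ P`. -/
theorem presDim_superadd {P X C : Submodule A M} (hC : C ≤ P) :
    presDim rk (X.map P.mkQ) + presDim rk C ≤ presDim rk (X ⊔ C) := by
  refine le_presDim fun r ⟨k, π, G, K, h1, h2, h3⟩ => ?_
  -- the part of `G` that maps to `C` gives relations for the quotient and generators for `C`
  let H := G ⊓ C.comap π
  have hH : freeRank rk (H ⊔ K) ≤ freeRank rk (G ⊔ K) :=
    freeRank_mono (by gcongr; exact inf_le_left)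
  have hK : freeRank rk K ≤ freeRank rk (H ⊔ K) := freeRank_mono le_sup_right
  have e1 : presDim rk (X.map P.mkQ) ≤ freeRank rk (G ⊔ K) - freeRank rk (H ⊔ K) := by
    refine HasPresentation.presDim_le ⟨k, P.mkQ ∘ₗ π, G, H ⊔ K, ?_, ?_, ?_⟩
    · rw [Submodule.map_comp]
      exact Submodule.map_mono (le_sup_left.trans h1)
    · refine sup_le ?_ (h2.trans (LinearMap.ker_le_ker_comp _ _))
      intro x hx
      simpa using hC hx.2
    · rw [← sup_assoc, sup_eq_left.2 (inf_le_left : H ≤ G), tsub_add_cancel_of_le hH]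
  have e2 : presDim rk C ≤ freeRank rk (H ⊔ K) - freeRank rk K := by
    refine HasPresentation.presDim_le ⟨k, π, H, K, ?_, h2, ?_⟩
    · intro c hc
      obtain ⟨x, hx, rfl⟩ := h1 ((le_sup_right : C ≤ X ⊔ C) hc)
      exact ⟨x, ⟨hx, hc⟩, rfl⟩
    · rw [tsub_add_cancel_of_le hK]
  refine (add_le_add e1 e2).trans ?_
  rw [tsub_add_tsub_cancel hH hK]
  exact tsub_le_iff_right.2 h3

theorem exists_fg_le_sup {P X Y : Submodule A M} (hX : X.FG) (h : X ≤ Y ⊔ P) :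
    ∃ C : Submodule A M, C.FG ∧ C ≤ P ∧ X ≤ Y ⊔ C := by
  obtain ⟨n, s, rfl⟩ := Submodule.fg_iff_exists_fin_generating_family.1 hX
  choose y hy p hp hyp using fun i =>
    Submodule.mem_sup.1 (h (Submodule.subset_span (Set.mem_range_self i)))
  refine ⟨Submodule.span A (Set.range p), Submodule.fg_span (Set.finite_range p), ?_, ?_⟩
  · rw [Submodule.span_le]
    rintro _ ⟨i, rfl⟩
    exact hp i
  · rw [Submodule.span_le]
    rintro _ ⟨i, rfl⟩
    rw [← hyp i]
    exact Submodule.add_mem_sup (hy i) (Submodule.subset_span ⟨i, rfl⟩)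

/-- A presentation of the image of `X` in `M ⧸ P` lifts to `M`, as only finitely many relations
matter. It is glued to an arbitrary presentation of a submodule `C` of `P` that contains the values
of the lifted relations. -/
theorem presDim_approx (hrk : IsSylvesterMatrixRank rk) {P X : Submodule A M} (hX : X.FG)
    {t : ℝ≥0∞} (ht : presDim rk (X.map P.mkQ) < t) : ∃ C₀ : Submodule A M, C₀.FG ∧ C₀ ≤ P ∧
      ∀ C : Submodule A M, C₀ ≤ C → C ≤ P → presDim rk (X ⊔ C) ≤ t + presDim rk C := by
  obtain ⟨r, ⟨k, π, G, K, h1, h2, h3⟩, hrt⟩ := sInf_lt_iff.1 ht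
  obtain ⟨π', hπ'⟩ := Module.projective_lifting_property P.mkQ π P.mkQ_surjective
  -- finitely many of the relations `K` carry almost all of their rank
  obtain ⟨l, y, hyK, hy⟩ : ∃ (l : ℕ) (y : Fin l → Fin k → A), (∀ i, y i ∈ K) ∧
      freeRank rk (G ⊔ K) ≤ t + freeRank rk (Submodule.span A (Set.range y)) := by
    rcases eq_or_ne (freeRank rk K) 0 with h0 | h0
    · refine ⟨0, 0, fun i => K.zero_mem, h3.trans ?_⟩
      rw [h0, add_zero]
      exact hrt.le.trans le_self_add
    · have hpos : 0 < t - r := tsub_pos_of_lt hrt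
      obtain ⟨n, m, φ, y, hy, hlt⟩ :=
        lt_freeRank (ENNReal.sub_lt_self (freeRank_ne_top hrk K) h0 hpos.ne')
      refine ⟨n, y, hy, h3.trans ?_⟩
      have h4 := hlt.le.trans (le_freeRank (X := Submodule.span A (Set.range y)) φ y
        fun i => Submodule.subset_span ⟨i, rfl⟩)
      rw [tsub_le_iff_right] at h4
      calc r + freeRank rk K
          ≤ r + (freeRank rk (Submodule.span A (Set.range y)) + (t - r)) := by gcongr
        _ = (r + (t - r)) + freeRank rk (Submodule.span A (Set.range y)) := by ring
        _ = _ := by rw [add_tsub_cancel_of_le hrt.le]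
  set K' := Submodule.span A (Set.range y) with hK'
  have hK'K : K' ≤ K := by
    rw [hK', Submodule.span_le]
    rintro _ ⟨i, rfl⟩
    exact hyK i
  have hmk : ∀ v, P.mkQ (π' v) = π v := fun v => LinearMap.congr_fun hπ' v
  have hπK : K'.map π' ≤ P := by
    rintro _ ⟨v, hv, rfl⟩
    have : P.mkQ (π' v) = 0 := by
      rw [hmk]
      exact h2 (hK'K hv)
    simpa using this
  obtain ⟨C₁, hC₁, hC₁P, hXC⟩ : ∃ C : Submodule A M, C.FG ∧ C ≤ P ∧ X ≤ G.map π' ⊔ C := by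
    refine exists_fg_le_sup hX fun x hx => ?_
    obtain ⟨v, hv, hvx⟩ := h1 (Submodule.mem_map_of_mem hx)
    rw [← hmk] at hvx
    have : x - π' v ∈ P := by
      rw [← Submodule.Quotient.mk_eq_zero P, Submodule.Quotient.mk_sub, sub_eq_zero]
      exact hvx.symm
    rw [← add_sub_cancel (π' v) x]
    exact Submodule.add_mem_sup ⟨v, hv, rfl⟩ this
  refine ⟨K'.map π' ⊔ C₁, ((Submodule.fg_span (Set.finite_range y)).map _).sup hC₁,
    sup_le hπK hC₁P, fun C hC hCP => ?_⟩
  have hKC : K'.map π' ≤ C := le_sup_left.trans hC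
  rw [← tsub_le_iff_left]
  refine le_presDim fun r' ⟨k', π'', Z, V, g1, g2, g3⟩ => ?_
  rw [tsub_le_iff_left]
  choose z hz hzy using fun i => g1 (hKC ⟨y i, Submodule.subset_span ⟨i, rfl⟩, rfl⟩)
  -- the relations of `M ⧸ P` that are lifted to `M` hold there up to elements of `C`
  let Γ : Submodule A ((Fin k → A) × (Fin k' → A)) :=
    Submodule.span A (Set.range fun i => (y i, -z i))
  let inl := LinearMap.inl A (Fin k → A) (Fin k' → A)
  let inr := LinearMap.inr A (Fin k → A) (Fin k' → A)
  refine presDim_le_of_free (finProdEquiv A k k').symm (π'.coprod π'') (G.map inl ⊔ Z.map inr)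
    (Γ ⊔ V.map inr) ?_ ?_ ?_
  · rw [Submodule.map_sup, ← Submodule.map_comp, ← Submodule.map_comp, LinearMap.coprod_inl,
      LinearMap.coprod_inr]
    refine sup_le (hXC.trans (sup_le_sup le_rfl ?_)) (g1.trans le_sup_right)
    exact (le_sup_right.trans hC).trans g1
  · refine sup_le ?_ ?_
    · rw [Submodule.span_le]
      rintro _ ⟨i, rfl⟩
      simp [hzy]
    · rintro _ ⟨v, hv, rfl⟩
      simpa [inr] using g2 hv
  · have hle : (G.map inl ⊔ Z.map inr) ⊔ (Γ ⊔ V.map inr) ≤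
        (G ⊔ K').map inl ⊔ (Z ⊔ V).map inr := by
      rw [Submodule.map_sup, Submodule.map_sup]
      refine sup_le (sup_le ?_ ?_) (sup_le ?_ ?_)
      · exact le_sup_left.trans le_sup_left
      · exact le_sup_left.trans le_sup_right
      · rw [Submodule.span_le]
        rintro _ ⟨i, rfl⟩
        have : ((y i, -z i) : (Fin k → A) × (Fin k' → A)) = inl (y i) + inr (-z i) := by
          simp [inl, inr]
        simp only [this]
        exact Submodule.add_mem_sup
          (le_sup_right (a := G.map inl) ⟨y i, Submodule.subset_span ⟨i, rfl⟩, rfl⟩)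
          (le_sup_left (b := V.map inr) ⟨_, Z.neg_mem (hz i), rfl⟩)
      · exact le_sup_right.trans le_sup_right
    have hV : freeRank rk V + freeRank rk K' ≤ freeRank rk (Γ ⊔ V.map inr) := by
      refine le_trans (add_le_add ?_ ?_) (freeRank_add_map_le hrk (LinearMap.fst A _ _)
        (le_sup_right : V.map inr ≤ Γ ⊔ V.map inr) ?_)
      · have := freeRank_map_le (rk := rk) (LinearMap.snd A (Fin k → A) (Fin k' → A)) (V.map inr)
        rwa [← Submodule.map_comp, LinearMap.snd_comp_inr, Submodule.map_id] at this
      · refine freeRank_mono ?_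
        rw [hK', Submodule.span_le]
        rintro _ ⟨i, rfl⟩
        exact ⟨(y i, -z i), (le_sup_left : Γ ≤ _) (Submodule.subset_span ⟨i, rfl⟩), rfl⟩
      · rintro _ ⟨v, -, rfl⟩
        simp [inr]
    calc _ ≤ freeRank rk (G ⊔ K') + freeRank rk (Z ⊔ V) :=
          (freeRank_mono hle).trans ((freeRank_sup_le hrk _ _).trans
            (add_le_add (freeRank_map_le _ _) (freeRank_map_le _ _)))
      _ ≤ (t + freeRank rk K') + (r' + freeRank rk V) := by
          gcongr
          exact (freeRank_mono (by gcongr)).trans hy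
      _ = t + r' + (freeRank rk V + freeRank rk K') := by ring
      _ ≤ _ := by gcongr

end

/-- The lower bound holds because for `K ⊆ ker π` the rank of the image of `G + K` under `π` is at
most the rank of `G + K` minus the rank of `K`. -/
theorem presDim_rowModule (hrk : IsSylvesterMatrixRank rk) {n m : ℕ}
    (P : Matrix (Fin n) (Fin m) A) : presDim rk (rowModule P) = rk P := by
  refine le_antisymm ?_ (le_presDim fun r ⟨k, π, G, K, h1, h2, h3⟩ => ?_)
  · refine HasPresentation.presDim_le ⟨m, LinearMap.id, rowModule P, ⊥, ?_, bot_le, ?_⟩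
    · simp
    · rw [sup_bot_eq, freeRank_rowModule hrk]
      exact le_self_add
  · have h4 := freeRank_add_map_le hrk π (le_sup_right : K ≤ G ⊔ K) h2
    have h5 : (rk P : ℝ≥0∞) ≤ freeRank rk ((G ⊔ K).map π) := by
      rw [← freeRank_rowModule hrk]
      exact freeRank_mono (h1.trans (Submodule.map_mono le_sup_left))
    have h6 := (add_le_add le_rfl h5).trans (h4.trans h3)
    rw [add_comm r] at h6
    exact (ENNReal.add_le_add_iff_left (freeRank_ne_top hrk K)).1 h6

theorem corresponds_bivariantDim (hrk : IsSylvesterMatrixRank rk) :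
    Corresponds (bivariantDim rk) rk := fun n m P => by
  rw [bivariantDim_of_fg (rowModule_fg P), presDim_rowModule hrk]

theorem isRankSystem_bivariantDim (hrk : IsSylvesterMatrixRank rk) :
    IsRankSystem (bivariantDim rk) where
  map_le_of_fg f P hP := by
    rw [bivariantDim_of_fg hP, bivariantDim_of_fg (hP.map f)]
    exact presDim_map_le f P
  sup M _ _ P := iSup_congr fun Q => iSup_congr fun hQ => by rw [bivariantDim_of_fg hQ]
  inf M _ _ P hP := by
    rw [bivariantDim_of_fg hP, presDim_inf]
    refine iInf_congr fun Q => iInf_congr fun hQ => iInf_congr fun hPQ => ?_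
    rw [bivariantDim_of_fg]
    refine Submodule.fg_of_fg_map_injective Q.subtype Q.injective_subtype ?_
    rwa [Submodule.submoduleOf, Submodule.map_comap_subtype, inf_eq_right.2 hPQ]
  one := by
    rw [bivariantDim_of_fg Module.Finite.fg_top]
    let e := LinearEquiv.funUnique (Fin 1) A A
    have h1 : presDim rk (⊤ : Submodule A (Fin 1 → A)) = 1 := by
      rw [← rowModule_one, presDim_rowModule hrk, hrk.one, ENNReal.coe_one]
    refine le_antisymm ?_ ?_
    · have := presDim_map_le (rk := rk) (e : (Fin 1 → A) →ₗ[A] A) ⊤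
      rwa [Submodule.map_top, LinearEquiv.range, h1] at this
    · have := presDim_map_le (rk := rk) (e.symm : A →ₗ[A] (Fin 1 → A)) ⊤
      rwa [Submodule.map_top, LinearEquiv.range, h1] at this
  superadd P X C hX hC hCP := by
    rw [bivariantDim_of_fg hC, bivariantDim_of_fg (hX.map _), bivariantDim_of_fg (hX.sup hC)]
    exact presDim_superadd hCP
  approx P X hX t ht := by
    rw [bivariantDim_of_fg (hX.map _)] at ht
    obtain ⟨C₀, h0, h1, h2⟩ := presDim_approx hrk hX ht
    refine ⟨C₀, h0, h1, fun C hC h3 h4 => ?_⟩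
    rw [bivariantDim_of_fg hC, bivariantDim_of_fg (hX.sup hC)]
    exact h2 C h3 h4

/-- The description in `bivariantOf` is satisfied by `bivariantDim rk` only. -/
theorem bivariantOf_eq (hrk : IsSylvesterMatrixRank rk) : bivariantOf rk = bivariantDim rk := by
  have h : IsBivariantRank (bivariantDim rk) ∧ Corresponds (bivariantDim rk) rk :=
    ⟨(isRankSystem_bivariantDim hrk).isBivariantRank, corresponds_bivariantDim hrk⟩
  have h' := Classical.epsilon_spec
    (p := fun d : BivariantFun A => IsBivariantRank d ∧ Corresponds d rk) ⟨_, h⟩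
  exact h'.1.eq_of_corresponds h.1 h'.2 h.2

theorem isRankSystem_bivariantOf (hrk : IsSylvesterMatrixRank rk) :
    IsRankSystem (bivariantOf rk) := by
  rw [bivariantOf_eq hrk]
  exact isRankSystem_bivariantDim hrk

theorem corresponds_bivariantOf (hrk : IsSylvesterMatrixRank rk) :
    Corresponds (bivariantOf rk) rk := by
  rw [bivariantOf_eq hrk]
  exact corresponds_bivariantDim hrk

/-! ### Semilinear maps -/

section Semilinear

variable (σ : A ≃+* A)

/-- The inverse image of a submodule of `Aᵏ` under the inverse of the automorphism `σ` of `Aᵏ`. -/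
def twist {k : ℕ} (X : Submodule A (Fin k → A)) : Submodule A (Fin k → A) where
  carrier := {v | (fun i => σ.symm (v i)) ∈ X}
  zero_mem' := by
    simp only [Set.mem_ofPred_eq, Pi.zero_apply, map_zero]
    exact X.zero_mem
  add_mem' {v w} hv hw := by
    simp only [Set.mem_ofPred_eq, Pi.add_apply, map_add]
    exact X.add_mem hv hw
  smul_mem' a v hv := by
    have := X.smul_mem (σ.symm a) hv
    simpa [Pi.smul_def] using this

theorem mem_twist {k : ℕ} {X : Submodule A (Fin k → A)} {v : Fin k → A} :
    v ∈ twist σ X ↔ (fun i => σ.symm (v i)) ∈ X := Iff.rfl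

variable {σ}

theorem freeRank_twist_le (hσ : ∀ (n m : ℕ) (P : Matrix (Fin n) (Fin m) A), rk (P.map σ) = rk P)
    {k : ℕ} (X : Submodule A (Fin k → A)) : freeRank rk (twist σ X) ≤ freeRank rk X := by
  refine freeRank_le fun n m φ x hx => ?_
  let ψ : (Fin k → A) →ₗ[A] Fin m → A :=
    { toFun := fun v i => σ.symm (φ (fun j => σ (v j)) i)
      map_add' := fun v w => by
        ext i
        have : (fun j => σ ((v + w) j)) = (fun j => σ (v j)) + fun j => σ (w j) := by
          ext j
          simp
        change σ.symm (φ (fun j => σ ((v + w) j)) i) = _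
        rw [this, map_add, Pi.add_apply, map_add]
        rfl
      map_smul' := fun a v => by
        ext i
        have : (fun j => σ ((a • v) j)) = σ a • fun j => σ (v j) := by
          ext j
          simp
        change σ.symm (φ (fun j => σ ((a • v) j)) i) = _
        rw [this, map_smul, Pi.smul_apply, smul_eq_mul, map_mul, RingEquiv.symm_apply_apply]
        rfl }
  have h := le_freeRank (rk := rk) ψ (fun i j => σ.symm (x i j)) hx
  rw [← hσ] at h
  convert h using 3
  ext i j
  simp [ψ]

theorem twist_symm_twist {k : ℕ} (X : Submodule A (Fin k → A)) :
    twist σ.symm (twist σ X) = X := by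
  ext v
  simp [mem_twist]

theorem freeRank_twist (hσ : ∀ (n m : ℕ) (P : Matrix (Fin n) (Fin m) A), rk (P.map σ) = rk P)
    {k : ℕ} (X : Submodule A (Fin k → A)) : freeRank rk (twist σ X) = freeRank rk X := by
  refine le_antisymm (freeRank_twist_le hσ X) ?_
  conv_lhs => rw [← twist_symm_twist (σ := σ) X]
  refine freeRank_twist_le (fun n m P => ?_) _
  rw [← hσ]
  congr 1
  ext i j
  simp

/-- Semilinear maps do not increase dimensions, if their automorphism preserves the rank. -/
theorem presDim_le_of_semilinear
    (hσ : ∀ (n m : ℕ) (P : Matrix (Fin n) (Fin m) A), rk (P.map σ) = rk P)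
    {M M' : Type u} [AddCommGroup M] [Module A M] [AddCommGroup M'] [Module A M']
    (f : M →+ M') (hf : ∀ (a : A) (x : M), f (a • x) = σ a • f x)
    {X : Submodule A M} {X' : Submodule A M'} (hX : ∀ y ∈ X', ∃ x ∈ X, f x = y) :
    presDim rk X' ≤ presDim rk X := by
  refine le_presDim fun r ⟨k, π, G, K, h1, h2, h3⟩ => ?_
  let π' : (Fin k → A) →ₗ[A] M' :=
    { toFun := fun v => f (π fun i => σ.symm (v i))
      map_add' := fun v w => by
        have : (fun i => σ.symm ((v + w) i)) = (fun i => σ.symm (v i)) + fun i => σ.symm (w i) := by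
          ext j
          simp
        simp only [this, map_add]
      map_smul' := fun a v => by
        have : (fun i => σ.symm ((a • v) i)) = σ.symm a • fun i => σ.symm (v i) := by
          ext j
          simp
        simp only [this, map_smul, hf, RingEquiv.apply_symm_apply, RingHom.id_apply] }
  refine HasPresentation.presDim_le ⟨k, π', twist σ G, twist σ K, ?_, ?_, ?_⟩
  · intro y hy
    obtain ⟨x, hx, rfl⟩ := hX y hy
    obtain ⟨v, hv, rfl⟩ := h1 hx
    exact ⟨fun i => σ (v i), by simpa [mem_twist] using hv, by simp [π']⟩
  · intro v hv
    have : π (fun i => σ.symm (v i)) = 0 := h2 hv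
    simp [π', this]
  · rw [freeRank_twist hσ K]
    refine le_trans ?_ h3
    rw [← freeRank_twist hσ (G ⊔ K)]
    refine freeRank_mono (sup_le ?_ ?_)
    · exact fun v hv => (le_sup_left : G ≤ G ⊔ K) hv
    · exact fun v hv => (le_sup_right : K ≤ G ⊔ K) hv

theorem bivariantOf_le_of_semilinear (hrk : IsSylvesterMatrixRank rk)
    (hσ : ∀ (n m : ℕ) (P : Matrix (Fin n) (Fin m) A), rk (P.map σ) = rk P)
    {M M' : Type u} [AddCommGroup M] [Module A M] [AddCommGroup M'] [Module A M']
    (f : M →+ M') (hf : ∀ (a : A) (x : M), f (a • x) = σ a • f x)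
    {X : Submodule A M} {X' : Submodule A M'} (hfg : X.FG) (hfg' : X'.FG)
    (hX : ∀ y ∈ X', ∃ x ∈ X, f x = y) : bivariantOf rk M' X' ≤ bivariantOf rk M X := by
  rw [bivariantOf_eq hrk, bivariantDim_of_fg hfg, bivariantDim_of_fg hfg']
  exact presDim_le_of_semilinear hσ f hf hX

end Semilinear

/-! ### Free modules -/

theorem bivariantOf_free (hrk : IsSylvesterMatrixRank rk) {M : Type u} [AddCommGroup M]
    [Module A M] {n : ℕ} (e : M ≃ₗ[A] (Fin n → A)) : bivariantOf rk M ⊤ = n := by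
  rw [(isRankSystem_bivariantOf hrk).top_equiv e, ← rowModule_one,
    ← corresponds_bivariantOf hrk, hrk.one_eq]
  simp

/-- Free modules have a well-defined rank, since `bivariantOf rk` takes the value `n` on `Aⁿ`. -/
theorem freeDim_eq (hrk : IsSylvesterMatrixRank rk) {M : Type u} [AddCommGroup M]
    [Module A M] {n : ℕ} (e : M ≃ₗ[A] (Fin n → A)) : freeDim A M = n := by
  have : {k : ℕ | Nonempty (M ≃ₗ[A] (Fin k → A))} = {n} := by
    ext k
    simp only [Set.mem_ofPred_eq, Set.mem_singleton_iff]
    constructor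
    · rintro ⟨e'⟩
      have := bivariantOf_free hrk e'
      rw [bivariantOf_free hrk e] at this
      exact_mod_cast this.symm
    · rintro rfl
      exact ⟨e⟩
  rw [freeDim, this, csInf_singleton]

theorem bivariantOf_top_eq_freeDim (hrk : IsSylvesterMatrixRank rk) {M : Type u} [AddCommGroup M]
    [Module A M] {n : ℕ} (e : M ≃ₗ[A] (Fin n → A)) : bivariantOf rk M ⊤ = freeDim A M := by
  rw [freeDim_eq hrk e, bivariantOf_free hrk e]

end MatrixRank

section AmenableExtension

variable {S : Type u} [Ring S] {R : Subring S}

/-! ### Products and translates of submodules -/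

section Products

variable {N : Type u} [AddCommGroup N] [Module S N]

theorem smul_mem_mulSub {W : Submodule R S} {M : Submodule R N} {w : S} {y : N} (hw : w ∈ W)
    (hy : y ∈ M) : w • y ∈ mulSub W M :=
  Submodule.subset_span ⟨w, hw, y, hy, rfl⟩

theorem mulSub_le {W : Submodule R S} {M X : Submodule R N} :
    mulSub W M ≤ X ↔ ∀ w ∈ W, ∀ y ∈ M, w • y ∈ X := by
  rw [mulSub, Submodule.span_le]
  constructor
  · exact fun h w hw y hy => h ⟨w, hw, y, hy, rfl⟩
  · rintro h _ ⟨w, hw, y, hy, rfl⟩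
    exact h w hw y hy

theorem mulSub_mono {W W' : Submodule R S} {M M' : Submodule R N} (h : W ≤ W') (h' : M ≤ M') :
    mulSub W M ≤ mulSub W' M' :=
  mulSub_le.2 fun _ hw _ hy => smul_mem_mulSub (h hw) (h' hy)

theorem mulSub_sup_left (W W' : Submodule R S) (M : Submodule R N) :
    mulSub (W ⊔ W') M = mulSub W M ⊔ mulSub W' M := by
  refine le_antisymm (mulSub_le.2 fun w hw y hy => ?_)
    (sup_le (mulSub_mono le_sup_left le_rfl) (mulSub_mono le_sup_right le_rfl))
  obtain ⟨a, ha, b, hb, rfl⟩ := Submodule.mem_sup.1 hw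
  rw [add_smul]
  exact Submodule.add_mem_sup (smul_mem_mulSub ha hy) (smul_mem_mulSub hb hy)

theorem mulSub_sup_right (W : Submodule R S) (M M' : Submodule R N) :
    mulSub W (M ⊔ M') = mulSub W M ⊔ mulSub W M' := by
  refine le_antisymm (mulSub_le.2 fun w hw y hy => ?_)
    (sup_le (mulSub_mono le_rfl le_sup_left) (mulSub_mono le_rfl le_sup_right))
  obtain ⟨a, ha, b, hb, rfl⟩ := Submodule.mem_sup.1 hy
  rw [smul_add]
  exact Submodule.add_mem_sup (smul_mem_mulSub hw ha) (smul_mem_mulSub hw hb)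

@[simp]
theorem mulSub_bot_left (M : Submodule R N) : mulSub (⊥ : Submodule R S) M = ⊥ := by
  rw [eq_bot_iff, mulSub_le]
  rintro w hw y -
  simp [(Submodule.mem_bot R).1 hw]

@[simp]
theorem mulSub_bot_right (W : Submodule R S) : mulSub W (⊥ : Submodule R N) = ⊥ := by
  rw [eq_bot_iff, mulSub_le]
  rintro w - y hy
  simp [(Submodule.mem_bot R).1 hy]

theorem mulSub_mulSub_le (W V : Submodule R S) (M : Submodule R N) :
    mulSub (mulSub W V) M ≤ mulSub W (mulSub V M) := by
  refine mulSub_le.2 fun w hw y hy => ?_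
  induction hw using Submodule.span_induction with
  | mem x h =>
    obtain ⟨a, ha, b, hb, rfl⟩ := h
    rw [smul_eq_mul, mul_smul]
    exact smul_mem_mulSub ha (smul_mem_mulSub hb hy)
  | zero =>
    rw [zero_smul]
    exact Submodule.zero_mem _
  | add a b _ _ ha hb =>
    rw [add_smul]
    exact Submodule.add_mem _ ha hb
  | smul r a _ ha =>
    rw [smul_assoc]
    exact Submodule.smul_mem _ r ha

theorem map_mulSub {N' : Type u} [AddCommGroup N'] [Module S N'] (f : N →ₗ[S] N')
    (W : Submodule R S) (M : Submodule R N) :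
    (mulSub W M).map (f.restrictScalars R) = mulSub W (M.map (f.restrictScalars R)) := by
  rw [mulSub, mulSub, Submodule.map_span]
  congr 1
  ext z
  constructor
  · rintro ⟨_, ⟨w, hw, y, hy, rfl⟩, rfl⟩
    exact ⟨w, hw, f y, ⟨y, hy, rfl⟩, by simp⟩
  · rintro ⟨w, hw, _, ⟨y, hy, rfl⟩, rfl⟩
    exact ⟨w • y, ⟨w, hw, y, hy, rfl⟩, by simp⟩

/-- The set `g X`, for an `R`-submodule `X` of an `S`-module and `g ∈ S` with `g R = R g`; see
`mem_translate`. For other `g` it is the `R`-submodule generated by `g X`. -/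
def translate (g : S) (X : Submodule R N) : Submodule R N :=
  Submodule.span R {x : N | ∃ y ∈ X, x = g • y}

theorem smul_mem_translate (g : S) {X : Submodule R N} {y : N} (hy : y ∈ X) :
    g • y ∈ translate g X :=
  Submodule.subset_span ⟨y, hy, rfl⟩

theorem translate_le {g : S} {X Y : Submodule R N} :
    translate g X ≤ Y ↔ ∀ y ∈ X, g • y ∈ Y := by
  rw [translate, Submodule.span_le]
  constructor
  · exact fun h y hy => h ⟨y, hy, rfl⟩
  · rintro h _ ⟨y, hy, rfl⟩
    exact h y hy

theorem translate_le_mulSub {g : S} {W : Submodule R S} (hg : g ∈ W) (M : Submodule R N) :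
    translate g M ≤ mulSub W M :=
  translate_le.2 fun _ hy => smul_mem_mulSub hg hy

theorem mulSub_iSup_span_le {ι : Type*} (g : ι → S) (M : Submodule R N) :
    mulSub (⨆ i, Submodule.span R {g i}) M ≤ ⨆ i, translate (g i) M := by
  refine mulSub_le.2 fun w hw y hy => ?_
  induction hw using Submodule.iSup_induction' with
  | mem i x hx =>
    obtain ⟨r, rfl⟩ := Submodule.mem_span_singleton.1 hx
    rw [smul_assoc]
    exact Submodule.smul_mem _ r (Submodule.mem_iSup_of_mem i (smul_mem_translate _ hy))
  | zero =>
    rw [zero_smul]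
    exact Submodule.zero_mem _
  | add a b _ _ ha hb =>
    rw [add_smul]
    exact Submodule.add_mem _ ha hb

theorem mulSub_iSup_span {ι : Type*} (g : ι → S) (M : Submodule R N) :
    mulSub (⨆ i, Submodule.span R {g i}) M = ⨆ i, translate (g i) M :=
  le_antisymm (mulSub_iSup_span_le g M) (iSup_le fun i => translate_le_mulSub
    (Submodule.mem_iSup_of_mem i (Submodule.mem_span_singleton_self _)) M)

theorem mulSub_translate_le (g : S) (V : Submodule R S) (M : Submodule R N) :
    mulSub (translate g V) M ≤ translate g (mulSub V M) := by
  refine mulSub_le.2 fun w hw y hy => ?_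
  induction hw using Submodule.span_induction with
  | mem x h =>
    obtain ⟨v, hv, rfl⟩ := h
    rw [smul_eq_mul, mul_smul]
    exact smul_mem_translate g (smul_mem_mulSub hv hy)
  | zero =>
    rw [zero_smul]
    exact Submodule.zero_mem _
  | add a b _ _ ha hb =>
    rw [add_smul]
    exact Submodule.add_mem _ ha hb
  | smul r a _ ha =>
    rw [smul_assoc]
    exact Submodule.smul_mem _ r ha

end Products

/-! ### The automorphisms attached to normalizers -/

section Normalizers

/-- The automorphism `σ` of `R` with `g a = σ(a) g`. -/
theorem exists_conj {g : S} (hg : g ∈ normalizers R) : ∃ σ : R ≃+* R, ∀ a : R, g * a = σ a * g := by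
  obtain ⟨-, h1, h2, h3⟩ := hg
  have hex : ∀ a : R, ∃ b : R, g * a = b * g := fun a => by
    have : g * (a : S) ∈ (fun a : S => g * a) '' (R : Set S) := ⟨a, a.2, rfl⟩
    rw [h3] at this
    obtain ⟨b, hb, hba⟩ := this
    exact ⟨⟨b, hb⟩, hba.symm⟩
  have hex' : ∀ b : R, ∃ a : R, g * a = b * g := fun b => by
    have : (b : S) * g ∈ (fun a : S => a * g) '' (R : Set S) := ⟨b, b.2, rfl⟩
    rw [← h3] at this
    obtain ⟨a, ha, hab⟩ := this
    exact ⟨⟨a, ha⟩, hab⟩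
  have hr : ∀ a b : S, a * g = b * g → a = b := fun a b h =>
    sub_eq_zero.1 (h2 _ (by rw [sub_mul, h, sub_self]))
  have hl : ∀ a b : S, g * a = g * b → a = b := fun a b h =>
    sub_eq_zero.1 (h1 _ (by rw [mul_sub, h, sub_self]))
  choose σ hσ using hex
  let f : R →+* R :=
    { toFun := σ
      map_one' := Subtype.ext (hr _ _ (by rw [← hσ]; simp))
      map_zero' := Subtype.ext (hr _ _ (by rw [← hσ]; simp))
      map_add' := fun a b => Subtype.ext (hr _ _ (by
        rw [← hσ, Subring.coe_add, Subring.coe_add, mul_add, add_mul, ← hσ, ← hσ]))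
      map_mul' := fun a b => Subtype.ext (hr _ _ (by
        rw [← hσ, Subring.coe_mul, Subring.coe_mul, mul_assoc, ← hσ b, ← mul_assoc, ← mul_assoc,
          ← hσ a])) }
  refine ⟨RingEquiv.ofBijective f ⟨fun a b h => Subtype.ext (hl _ _ ?_), fun b => ?_⟩, hσ⟩
  · change σ a = σ b at h
    rw [hσ, hσ, h]
  · obtain ⟨a, ha⟩ := hex' b
    exact ⟨a, Subtype.ext (hr _ _ (by rw [← ha]; exact (hσ a).symm))⟩

theorem mem_translate {N : Type u} [AddCommGroup N] [Module S N] {g : S} (hg : g ∈ normalizers R)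
    {X : Submodule R N} {z : N} : z ∈ translate g X ↔ ∃ y ∈ X, z = g • y := by
  refine ⟨fun hz => ?_, ?_⟩
  · obtain ⟨σ, hσ⟩ := exists_conj hg
    induction hz using Submodule.span_induction with
    | mem x h => exact h
    | zero => exact ⟨0, X.zero_mem, by simp⟩
    | add a b _ _ ha hb =>
      obtain ⟨y, hy, rfl⟩ := ha
      obtain ⟨z, hz, rfl⟩ := hb
      exact ⟨y + z, X.add_mem hy hz, by simp⟩
    | smul r a _ ha =>
      obtain ⟨y, hy, rfl⟩ := ha
      refine ⟨σ.symm r • y, X.smul_mem _ hy, ?_⟩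
      have := hσ (σ.symm r)
      rw [RingEquiv.apply_symm_apply] at this
      rw [Subring.smul_def, Subring.smul_def, ← mul_smul, ← mul_smul, this]
  · rintro ⟨y, hy, rfl⟩
    exact smul_mem_translate g hy

theorem translate_span {N : Type u} [AddCommGroup N] [Module S N] {g : S}
    (hg : g ∈ normalizers R) (s : Set N) :
    translate g (Submodule.span R s) = Submodule.span R ((fun x => g • x) '' s) := by
  obtain ⟨σ, hσ⟩ := exists_conj hg
  refine le_antisymm (translate_le.2 fun y hy => ?_) (Submodule.span_le.2 ?_)
  · induction hy using Submodule.span_induction with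
    | mem x h => exact Submodule.subset_span ⟨x, h, rfl⟩
    | zero => simp
    | add a b _ _ ha hb =>
      rw [smul_add]
      exact Submodule.add_mem _ ha hb
    | smul r a _ ha =>
      rw [Subring.smul_def, ← mul_smul, hσ, mul_smul]
      exact Submodule.smul_mem _ (σ r) ha
  · rintro _ ⟨x, hx, rfl⟩
    exact smul_mem_translate g (Submodule.subset_span hx)

theorem translate_fg {N : Type u} [AddCommGroup N] [Module S N] {g : S}
    (hg : g ∈ normalizers R) {X : Submodule R N} (hX : X.FG) : (translate g X).FG := by
  obtain ⟨n, s, rfl⟩ := Submodule.fg_iff_exists_fin_generating_family.1 hX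
  rw [translate_span hg]
  exact Submodule.fg_span ((Set.finite_range s).image _)

end Normalizers

/-! ### Dimensions in an amenable normal extension -/

/-- The data of an amenable normal extension, together with a matrix rank function of `R` that it
preserves. -/
structure IsAmenableNormal (rk : MatrixFun R) (F : Set (Submodule R S)) (U : Submonoid S) :
    Prop where
  rank : IsSylvesterMatrixRank rk
  system : IsFiniteApproximationSystem F
  amenable : IsRightAmenable F
  normal : IsNormalSystem F U
  preserve : PreservesRank U rk

variable {rk : MatrixFun R} {F : Set (Submodule R S)} {U : Submonoid S}
variable {N : Type u} [AddCommGroup N] [Module S N]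

namespace IsAmenableNormal

theorem sys (H : IsAmenableNormal rk F U) : IsRankSystem (bivariantOf rk) :=
  isRankSystem_bivariantOf H.rank

theorem mem_normalizers (H : IsAmenableNormal rk F U) {g : S} (hg : g ∈ U) : g ∈ normalizers R :=
  H.normal.subset hg

theorem bot_mem (H : IsAmenableNormal rk F U) : (⊥ : Submodule R S) ∈ F := by
  obtain ⟨W, hW, -⟩ := H.system.exhaust ⊥ Submodule.fg_bot
  obtain ⟨V, hV, h1, h2⟩ := H.system.compl W hW W hW le_rfl
  have : V = ⊥ := by
    rw [← h1.eq_bot, eq_comm, inf_eq_right, ← h2]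
    exact le_sup_right
  rwa [← this]

theorem iSup_mem (H : IsAmenableNormal rk F U) {n : ℕ} {f : Fin n → Submodule R S}
    (hf : ∀ i, f i ∈ F) : ⨆ i, f i ∈ F := by
  rw [← Finset.sup_univ_eq_iSup]
  exact Finset.sup_induction H.bot_mem (fun a ha b hb => H.system.sup_mem a ha b hb)
    fun i _ => hf i

/-- Members of `F` are sums of lines spanned by a basis in `U`. -/
theorem exists_basis (H : IsAmenableNormal rk F U) {W : Submodule R S} (hW : W ∈ F) :
    ∃ g : Fin (freeDim R W) → S, (∀ i, g i ∈ U) ∧ W = ⨆ i, Submodule.span R {g i} := by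
  obtain ⟨n, b, hb⟩ := H.normal.basis W hW
  obtain rfl := freeDim_eq H.rank b.equivFun
  refine ⟨fun i => b i, hb, ?_⟩
  have := congrArg (Submodule.map W.subtype) b.span_eq
  rw [Submodule.map_span, Submodule.map_top, Submodule.range_subtype] at this
  rw [← Submodule.span_range_eq_iSup]
  rw [← Set.range_comp] at this
  exact this.symm

theorem exists_equiv (H : IsAmenableNormal rk F U) {W : Submodule R S} (hW : W ∈ F) :
    Nonempty (W ≃ₗ[R] (Fin (freeDim R W) → R)) := by
  obtain ⟨n, b, hb⟩ := H.normal.basis W hW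
  obtain rfl := freeDim_eq H.rank b.equivFun
  exact ⟨b.equivFun⟩

theorem fg (H : IsAmenableNormal rk F U) {W : Submodule R S} (hW : W ∈ F) : W.FG := by
  have := (H.system.free W hW).1
  exact Module.Finite.iff_fg.1 this

theorem dim_top (H : IsAmenableNormal rk F U) {W : Submodule R S} (hW : W ∈ F) :
    bivariantOf rk W ⊤ = freeDim R W :=
  bivariantOf_top_eq_freeDim H.rank (H.exists_equiv hW).some

/-- Members of `F` are `R`-bimodules. -/
theorem mul_mem (H : IsAmenableNormal rk F U) {W : Submodule R S} (hW : W ∈ F) {w : S}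
    (hw : w ∈ W) (a : R) : w * a ∈ W := by
  obtain ⟨g, hg, hWg⟩ := H.exists_basis hW
  rw [hWg] at hw
  induction hw using Submodule.iSup_induction' with
  | mem i x hx =>
    obtain ⟨r, rfl⟩ := Submodule.mem_span_singleton.1 hx
    obtain ⟨σ, hσ⟩ := exists_conj (H.mem_normalizers (hg i))
    rw [Subring.smul_def, smul_eq_mul, mul_assoc, hσ]
    have hgi : g i ∈ W := by
      rw [hWg]
      exact Submodule.mem_iSup_of_mem i (Submodule.mem_span_singleton_self _)
    exact W.smul_mem r (W.smul_mem (σ a) hgi)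
  | zero => simp
  | add a b _ _ ha hb =>
    rw [add_mul]
    exact W.add_mem ha hb

theorem mulSub_span_le (H : IsAmenableNormal rk F U) {W : Submodule R S} (hW : W ∈ F) {s : Set N}
    {X : Submodule R N} (h : ∀ w ∈ W, ∀ y ∈ s, w • y ∈ X) : mulSub W (Submodule.span R s) ≤ X := by
  refine mulSub_le.2 fun w hw y hy => ?_
  induction hy using Submodule.span_induction generalizing w with
  | mem x hx => exact h w hw x hx
  | zero => simp
  | add a b _ _ ha hb =>
    rw [smul_add]
    exact X.add_mem (ha w hw) (hb w hw)
  | smul r a _ ha =>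
    rw [Subring.smul_def, ← mul_smul]
    exact ha _ (H.mul_mem hW hw r)

theorem mulSub_mulSub (H : IsAmenableNormal rk F U) {W : Submodule R S} (hW : W ∈ F)
    (V : Submodule R S) (M : Submodule R N) :
    mulSub W (mulSub V M) = mulSub (mulSub W V) M := by
  refine le_antisymm (H.mulSub_span_le hW ?_) (mulSub_mulSub_le W V M)
  rintro w hw _ ⟨v, hv, y, hy, rfl⟩
  rw [← mul_smul]
  exact smul_mem_mulSub (smul_mem_mulSub (N := S) hw hv) hy

theorem mulSub_fg (H : IsAmenableNormal rk F U) {W : Submodule R S} (hW : W ∈ F)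
    {M : Submodule R N} (hM : M.FG) : (mulSub W M).FG := by
  obtain ⟨g, hg, hWg⟩ := H.exists_basis hW
  rw [hWg, mulSub_iSup_span]
  exact Submodule.fg_iSup _ fun i => translate_fg (H.mem_normalizers (hg i)) hM

theorem translate_mem (H : IsAmenableNormal rk F U) {g : S} (hg : g ∈ U) {W : Submodule R S}
    (hW : W ∈ F) : translate g W ∈ F := by
  obtain ⟨b, hb, hWb⟩ := H.exists_basis hW
  rw [hWb, ← Submodule.span_range_eq_iSup, translate_span (H.mem_normalizers hg), ← Set.range_comp,
    Submodule.span_range_eq_iSup]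
  exact H.iSup_mem fun i => H.normal.line_mem _ (U.mul_mem hg (hb i))

theorem mulSub_mem (H : IsAmenableNormal rk F U) {W V : Submodule R S} (hW : W ∈ F)
    (hV : V ∈ F) : mulSub W V ∈ F := by
  obtain ⟨g, hg, hWg⟩ := H.exists_basis hW
  rw [hWg, mulSub_iSup_span]
  exact H.iSup_mem fun i => H.translate_mem (hg i) hV

theorem freeDim_bot (H : IsAmenableNormal rk F U) : freeDim R (⊥ : Submodule R S) = 0 := by
  have h1 := H.dim_top H.bot_mem
  rw [Subsingleton.elim (⊤ : Submodule R (⊥ : Submodule R S)) ⊥, H.sys.bot] at h1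
  exact_mod_cast h1.symm

theorem freeDim_pos (H : IsAmenableNormal rk F U) {W : Submodule R S}
    (hW : W ∈ nonzeroPart F) : 0 < freeDim R W := by
  rw [Nat.pos_iff_ne_zero]
  intro h
  obtain ⟨e⟩ := H.exists_equiv hW.1
  refine hW.2 (W.eq_bot_iff.2 fun x hx => ?_)
  have : (⟨x, hx⟩ : W) = 0 := by
    apply e.injective
    ext i
    rw [h] at i
    exact i.elim0
  simpa using this

theorem freeDim_sup_of_disjoint (H : IsAmenableNormal rk F U) {V W : Submodule R S} (hV : V ∈ F)
    (hW : W ∈ F) (h : Disjoint V W) :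
    freeDim R (V ⊔ W : Submodule R S) = freeDim R V + freeDim R W := by
  let f : (V × W) →ₗ[R] S := V.subtype.coprod W.subtype
  have hf : Function.Injective f := by
    rw [injective_iff_map_eq_zero]
    rintro ⟨⟨v, hv⟩, ⟨w, hw⟩⟩ hvw
    have h0 : v + w = 0 := by simpa [f] using hvw
    have hvW : v ∈ W := by
      rw [eq_neg_of_add_eq_zero_left h0]
      exact W.neg_mem hw
    have hv0 : v = 0 := (Submodule.disjoint_def.1 h) v hv hvW
    subst hv0
    rw [zero_add] at h0
    subst h0
    rfl
  have hr : LinearMap.range f = V ⊔ W := by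
    rw [LinearMap.range_coprod, Submodule.range_subtype, Submodule.range_subtype]
  have e : (V × W) ≃ₗ[R] (V ⊔ W : Submodule R S) :=
    (LinearEquiv.ofInjective f hf).trans (LinearEquiv.ofEq _ _ hr)
  have h1 := H.sys.top_equiv e
  rw [← Submodule.prod_top, H.sys.prod_eq, H.dim_top hV, H.dim_top hW,
    H.dim_top (H.system.sup_mem V hV W hW)] at h1
  exact_mod_cast h1.symm

theorem freeDim_sup_add_inf (H : IsAmenableNormal rk F U) {V W : Submodule R S} (hV : V ∈ F)
    (hW : W ∈ F) : freeDim R (V ⊔ W : Submodule R S) + freeDim R (V ⊓ W : Submodule R S) =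
      freeDim R V + freeDim R W := by
  obtain ⟨C, hC, h1, h2⟩ := H.system.compl V hV (V ⊓ W) (H.system.inf_mem V hV W hW) inf_le_left
  have hCV : C ≤ V := by
    rw [← h2]
    exact le_sup_right
  have h3 : Disjoint C W := by
    rw [disjoint_iff, ← le_bot_iff, ← h1.eq_bot]
    exact le_inf (le_inf (inf_le_left.trans hCV) inf_le_right) inf_le_left
  have h4 : V ⊔ W = C ⊔ W := by
    refine le_antisymm (sup_le ?_ le_sup_right) (sup_le_sup_right hCV W)
    rw [← h2]
    exact sup_le (inf_le_right.trans le_sup_right) le_sup_left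
  rw [h4, H.freeDim_sup_of_disjoint hC hW h3]
  conv_rhs => rw [← h2, H.freeDim_sup_of_disjoint (H.system.inf_mem V hV W hW) hC h1]
  ring

theorem freeDim_mono (H : IsAmenableNormal rk F U) {V W : Submodule R S} (hV : V ∈ F)
    (hW : W ∈ F) (h : V ≤ W) : freeDim R V ≤ freeDim R W := by
  obtain ⟨C, hC, h1, rfl⟩ := H.system.compl W hW V hV h
  rw [H.freeDim_sup_of_disjoint hV hC h1]
  exact Nat.le_add_right _ _

theorem freeDim_lt (H : IsAmenableNormal rk F U) {V W : Submodule R S} (hV : V ∈ F)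
    (hW : W ∈ F) (h : V < W) : freeDim R V < freeDim R W := by
  obtain ⟨C, hC, h1, rfl⟩ := H.system.compl W hW V hV h.le
  rw [H.freeDim_sup_of_disjoint hV hC h1]
  refine Nat.lt_add_of_pos_right (H.freeDim_pos ⟨hC, ?_⟩)
  rintro rfl
  simp at h

/-- Left multiplication by an element of `U` does not increase dimensions, also relative to
submodules. -/
theorem dim_translate_le (H : IsAmenableNormal rk F U) {g : S} (hg : g ∈ U)
    {X Q Q' : Submodule R N} (hX : X.FG) (hQ : translate g Q ≤ Q') :
    bivariantOf rk (N ⧸ Q') ((translate g X).map Q'.mkQ) ≤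
      bivariantOf rk (N ⧸ Q) (X.map Q.mkQ) := by
  have hg' := H.mem_normalizers hg
  obtain ⟨σ, hσ⟩ := exists_conj hg'
  have hσrk : ∀ (n m : ℕ) (P : Matrix (Fin n) (Fin m) R), rk (P.map σ) = rk P :=
    fun n m P => H.preserve g hg n m P _ fun i j => hσ _
  let f : (N ⧸ Q) →+ (N ⧸ Q') := QuotientAddGroup.map Q.toAddSubgroup Q'.toAddSubgroup
    (DistribSMul.toAddMonoidHom N g) (fun x hx => hQ (smul_mem_translate g hx))
  have hf : ∀ x : N, f (Q.mkQ x) = Q'.mkQ (g • x) := fun x => rfl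
  refine bivariantOf_le_of_semilinear H.rank hσrk f ?_ (hX.map _) ((translate_fg hg' hX).map _) ?_
  · intro a x
    obtain ⟨x, rfl⟩ := Q.mkQ_surjective x
    rw [← map_smul, hf, hf, ← map_smul, Subring.smul_def, Subring.smul_def, ← mul_smul, ← mul_smul,
      hσ]
  · rintro _ ⟨z, hz, rfl⟩
    obtain ⟨y, hy, rfl⟩ := (mem_translate hg').1 hz
    exact ⟨_, ⟨y, hy, rfl⟩, hf y⟩

theorem freeDim_translate (H : IsAmenableNormal rk F U) {g : S} (hg : g ∈ U) {W : Submodule R S}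
    (hW : W ∈ F) : freeDim R (translate g W) = freeDim R W := by
  have hg' := H.mem_normalizers hg
  obtain ⟨n, b, hb⟩ := H.normal.basis W hW
  obtain ⟨σ, hσ⟩ := exists_conj hg'
  let v : Fin n → S := fun i => g * b i
  have hv : LinearIndependent R v := by
    rw [Fintype.linearIndependent_iff]
    intro c hc i
    have h1 : g * ((∑ i, σ.symm (c i) • b i : W) : S) = 0 := by
      rw [← hc]
      simp only [AddSubmonoidClass.coe_finsetSum, Finset.mul_sum, v]
      refine Finset.sum_congr rfl fun j _ => ?_
      have := hσ (σ.symm (c j))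
      rw [RingEquiv.apply_symm_apply] at this
      rw [Submodule.coe_smul, Subring.smul_def, Subring.smul_def, smul_eq_mul, smul_eq_mul,
        ← mul_assoc, ← mul_assoc, this]
    have h2 : (∑ i, σ.symm (c i) • b i : W) = 0 := Subtype.ext (hg'.2.1 _ h1)
    have h3 := Fintype.linearIndependent_iff.1 b.linearIndependent _ h2 i
    simpa using h3
  have hspan : Submodule.span R (Set.range v) = translate g W := by
    have := congrArg (Submodule.map W.subtype) b.span_eq
    rw [Submodule.map_span, Submodule.map_top, Submodule.range_subtype] at this
    rw [← this, translate_span hg', ← Set.range_comp, ← Set.range_comp]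
    rfl
  rw [freeDim_eq H.rank b.equivFun, ← hspan]
  exact freeDim_eq H.rank (Module.Basis.span hv).equivFun

/-- Right multiplication by an element of `U` embeds `W` into `W V` if that element is in `V`. -/
theorem freeDim_le_mulSub (H : IsAmenableNormal rk F U) {W V : Submodule R S} (hW : W ∈ F)
    (hV : V ∈ nonzeroPart F) : freeDim R W ≤ freeDim R (mulSub W V) := by
  obtain ⟨g, hg, hVg⟩ := H.exists_basis hV.1
  let i : Fin (freeDim R V) := ⟨0, H.freeDim_pos hV⟩
  have hi : g i ∈ V := by
    rw [hVg]
    exact Submodule.mem_iSup_of_mem i (Submodule.mem_span_singleton_self _)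
  let f : S →ₗ[R] S :=
    { toFun := fun x => x * g i
      map_add' := fun x y => add_mul x y _
      map_smul' := fun r x => by simp [Subring.smul_def, mul_assoc] }
  have hf : Function.Injective f := (injective_iff_map_eq_zero f).2 fun x hx =>
    (H.mem_normalizers (hg i)).2.2.1 x hx
  have hWf : W.map f = mulSub W (Submodule.span R {g i}) := by
    refine le_antisymm ?_ (H.mulSub_span_le hW ?_)
    · rintro _ ⟨w, hw, rfl⟩
      exact smul_mem_mulSub (N := S) hw (Submodule.mem_span_singleton_self _)
    · rintro w hw _ rfl
      exact ⟨w, hw, rfl⟩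
  have h1 := H.mulSub_mem hW (H.normal.line_mem _ (hg i))
  have h2 : freeDim R W = freeDim R (mulSub W (Submodule.span R {g i})) := by
    obtain ⟨e⟩ := H.exists_equiv hW
    rw [← hWf]
    exact (freeDim_eq H.rank ((Submodule.equivMapOfInjective f hf W).symm.trans e)).symm
  rw [h2]
  refine H.freeDim_mono h1 (H.mulSub_mem hW hV.1) (mulSub_mono le_rfl ?_)
  rw [Submodule.span_singleton_le_iff_mem]
  exact hi

/-- Submodules of `Wᵐ` have the same dimension in `Wᵐ` and in `Sᵐ`, as `W` is a direct summand of
every larger member of `F`. -/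
theorem dim_pi (H : IsAmenableNormal rk F U) {W : Submodule R S} (hW : W ∈ F) (m : ℕ)
    (X : Submodule R (Fin m → W)) (hX : X.FG) :
    bivariantOf rk (Fin m → S) (X.map (W.subtype.compLeft (Fin m))) =
      bivariantOf rk (Fin m → W) X := by
  refine le_antisymm (H.sys.map_le _ _) ?_
  rw [H.sys.inf _ _ (hX.map _)]
  refine le_iInf fun Y => le_iInf fun hY => le_iInf fun hXY => ?_
  -- `Y` lies in `W'ᵐ`, which retracts onto `Wᵐ`
  obtain ⟨W', hW', hle⟩ := H.system.exhaust (W ⊔ ⨆ j : Fin m, Y.map (LinearMap.proj j))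
    ((H.fg hW).sup (Submodule.fg_iSup _ fun j => hY.map _))
  obtain ⟨C, -, hdisj, hsup⟩ := H.system.compl W' hW' W hW (le_sup_left.trans hle)
  have hWW' : W ≤ W' := le_sup_left.trans hle
  have hCW' : C ≤ W' := by
    rw [← hsup]
    exact le_sup_right
  have hcompl : IsCompl (W.submoduleOf W') (C.submoduleOf W') := by
    constructor
    · rw [Submodule.disjoint_def]
      rintro ⟨x, hx⟩ h1 h2
      exact Subtype.ext ((Submodule.disjoint_def.1 hdisj) x h1 h2)
    · rw [codisjoint_iff, ← Submodule.submoduleOf_sup_of_le hWW' hCW', hsup,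
        Submodule.submoduleOf_self]
  let p : W' →ₗ[R] W := (Submodule.submoduleOfEquivOfLe hWW' : _ →ₗ[R] W) ∘ₗ
    Submodule.projectionOnto _ _ hcompl
  have hp : ∀ (x : S) (hx : x ∈ W), p ⟨x, hWW' hx⟩ = ⟨x, hx⟩ := by
    intro x hx
    have := Submodule.projectionOnto_apply_left hcompl ⟨⟨x, hWW' hx⟩, hx⟩
    exact congrArg (Submodule.submoduleOfEquivOfLe hWW') this
  have hYW : ∀ y : Y, ∀ j, (y : Fin m → S) j ∈ W' := fun y j =>
    hle ((le_sup_right : _ ≤ W ⊔ _) (Submodule.mem_iSup_of_mem j ⟨y, y.2, rfl⟩))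
  let q : Y →ₗ[R] (Fin m → W) := LinearMap.pi fun j =>
    p ∘ₗ ((LinearMap.proj j ∘ₗ Y.subtype).codRestrict W' fun y => hYW y j)
  refine le_trans (H.sys.mono ?_) (H.sys.map_le q _)
  intro x hx
  have hxY : W.subtype.compLeft (Fin m) x ∈ Y := hXY ⟨x, hx, rfl⟩
  refine ⟨⟨_, hxY⟩, ⟨x, hx, rfl⟩, ?_⟩
  ext j
  exact congrArg Subtype.val (hp (x j) (x j).2)

theorem dim_eq (H : IsAmenableNormal rk F U) {W : Submodule R S} (hW : W ∈ F) :
    bivariantOf rk S W = freeDim R W := by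
  have h0 : (⊤ : Submodule R W).FG := (Submodule.fg_top W).2 (H.fg hW)
  have e := LinearEquiv.funUnique (Fin 1) R W
  have h1 := H.dim_pi hW 1 ⊤ (h0.map (e.symm : W →ₗ[R] (Fin 1 → W)) |> fun h => by
    rwa [Submodule.map_top, LinearEquiv.range] at h)
  rw [H.sys.top_equiv e, H.dim_top hW,
    ← H.sys.map_equiv (LinearEquiv.funUnique (Fin 1) R S)] at h1
  rw [← h1]
  congr 1
  ext x
  constructor
  · exact fun hx => ⟨fun _ => x, ⟨fun _ => ⟨x, hx⟩, trivial, rfl⟩, rfl⟩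
  · rintro ⟨_, ⟨y, -, rfl⟩, rfl⟩
    exact (y 0).2

end IsAmenableNormal

/-- The dimension of the image of `X` in `N ⧸ Q`, for `R`-submodules `Q` and `X` of `N`. -/
def relDim (rk : MatrixFun R) (Q X : Submodule R N) : ℝ≥0∞ :=
  bivariantOf rk (N ⧸ Q) (X.map Q.mkQ)

namespace IsAmenableNormal

theorem relDim_bot (H : IsAmenableNormal rk F U) (X : Submodule R N) :
    relDim rk ⊥ X = bivariantOf rk N X := H.sys.quot_bot X

theorem relDim_le (H : IsAmenableNormal rk F U) (Q X : Submodule R N) :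
    relDim rk Q X ≤ bivariantOf rk N X := H.sys.map_le _ _

theorem relDim_ne_top (H : IsAmenableNormal rk F U) (Q : Submodule R N) {X : Submodule R N}
    (hX : X.FG) : relDim rk Q X ≠ ⊤ := (H.sys.lt_top (hX.map _)).ne

theorem relDim_mono (H : IsAmenableNormal rk F U) (Q : Submodule R N) {X Y : Submodule R N}
    (h : X ≤ Y) : relDim rk Q X ≤ relDim rk Q Y := H.sys.mono (Submodule.map_mono h)

theorem relDim_anti (H : IsAmenableNormal rk F U) {P Q : Submodule R N} (h : P ≤ Q)
    (X : Submodule R N) : relDim rk Q X ≤ relDim rk P X := H.sys.quot_anti h X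

theorem relDim_sup_le (H : IsAmenableNormal rk F U) (Q : Submodule R N) {X Y : Submodule R N}
    (hX : X.FG) (hY : Y.FG) : relDim rk Q (X ⊔ Y) ≤ relDim rk Q X + relDim rk Q Y := by
  rw [relDim, Submodule.map_sup]
  exact H.sys.sup_le (hX.map _) (hY.map _)

/-- `W ↦ dim(W M)` is strongly subadditive on the lattice `F`, also modulo `Q`. -/
theorem relDim_submodular (H : IsAmenableNormal rk F U) (Q : Submodule R N) {M : Submodule R N}
    (hM : M.FG) {V W : Submodule R S} (hV : V ∈ F) (hW : W ∈ F) :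
    relDim rk Q (mulSub (V ⊔ W) M) + relDim rk Q (mulSub (V ⊓ W) M) ≤
      relDim rk Q (mulSub V M) + relDim rk Q (mulSub W M) := by
  simp only [relDim]
  rw [mulSub_sup_left, Submodule.map_sup]
  exact H.sys.submodular ((H.mulSub_fg hV hM).map _) ((H.mulSub_fg hW hM).map _)
    ((H.mulSub_fg (H.system.inf_mem V hV W hW) hM).map _)
    (Submodule.map_mono (mulSub_mono inf_le_left le_rfl))
    (Submodule.map_mono (mulSub_mono inf_le_right le_rfl))

theorem dim_mulSub_le (H : IsAmenableNormal rk F U) {M : Submodule R N} (hM : M.FG)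
    {V : Submodule R S} (hV : V ∈ F) :
    bivariantOf rk N (mulSub V M) ≤ freeDim R V * bivariantOf rk N M := by
  obtain ⟨g, hg, hVg⟩ := H.exists_basis hV
  have h : mulSub V M = ⨆ i, translate (g i) M := by
    rw [← mulSub_iSup_span, ← hVg]
  rw [h]
  refine H.sys.iSup_le_mul (fun i => translate_fg (H.mem_normalizers (hg i)) hM) fun i => ?_
  have := H.dim_translate_le (hg i) (Q := ⊥) (Q' := ⊥) hM (by
    rw [translate_le]
    rintro y hy
    simp [(Submodule.mem_bot R).1 hy])
  rwa [H.sys.quot_bot, H.sys.quot_bot] at this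

theorem relDim_mulSub_le_add (H : IsAmenableNormal rk F U) (Q : Submodule R N) {M : Submodule R N}
    (hM : M.FG) {V W : Submodule R S} (hV : V ∈ F) (hW : W ∈ F) (h : V ≤ W) :
    relDim rk Q (mulSub W M) ≤ relDim rk Q (mulSub V M) +
      ((freeDim R W - freeDim R V : ℕ) : ℝ≥0∞) * bivariantOf rk N M := by
  obtain ⟨C, hC, h1, rfl⟩ := H.system.compl W hW V hV h
  rw [H.freeDim_sup_of_disjoint hV hC h1, Nat.add_sub_cancel_left, mulSub_sup_left]
  refine (H.relDim_sup_le Q (H.mulSub_fg hV hM) (H.mulSub_fg hC hM)).trans ?_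
  gcongr
  exact (H.relDim_le _ _).trans (H.dim_mulSub_le hM hC)

/-! ### The filter of invariance -/

theorem invariant_mono (H : IsAmenableNormal rk F U) {V V' W : Submodule R S} {δ δ' : ℝ}
    (hV : V ∈ F) (hV' : V' ∈ F) (hW : W ∈ F) (h : V ≤ V') (hδ : δ' ≤ δ)
    (hinv : Invariant V' δ' W) : Invariant V δ W := by
  refine le_trans ?_ (hinv.trans ?_)
  · have := H.freeDim_mono (H.system.sup_mem W hW _ (H.mulSub_mem hW hV))
      (H.system.sup_mem W hW _ (H.mulSub_mem hW hV'))
      (sup_le_sup_left (mulSub_mono le_rfl h) W)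
    exact_mod_cast this
  · gcongr

/-- The filter along which `W ∈ F` becomes more and more right invariant. -/
def folner (H : IsAmenableNormal rk F U) : Filter (Submodule R S) where
  sets := {s | ∃ V ∈ F, ∃ δ : ℝ, 0 < δ ∧ ∀ W ∈ nonzeroPart F, Invariant V δ W → W ∈ s}
  univ_sets := ⟨⊥, H.bot_mem, 1, one_pos, fun _ _ _ => trivial⟩
  sets_of_superset := fun ⟨V, hV, δ, hδ, h⟩ hst =>
    ⟨V, hV, δ, hδ, fun W hW hinv => hst (h W hW hinv)⟩
  inter_sets := fun ⟨V, hV, δ, hδ, h⟩ ⟨V', hV', δ', hδ', h'⟩ => by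
    refine ⟨V ⊔ V', H.system.sup_mem V hV V' hV', min δ δ', lt_min hδ hδ',
      fun W hW hinv => ⟨h W hW ?_, h' W hW ?_⟩⟩
    · exact invariant_mono H hV (H.system.sup_mem V hV V' hV') hW.1 le_sup_left
        (min_le_left _ _) hinv
    · exact invariant_mono H hV' (H.system.sup_mem V hV V' hV') hW.1 le_sup_right
        (min_le_right _ _) hinv

theorem folnerTendsto_iff (H : IsAmenableNormal rk F U) {X : Type*} [TopologicalSpace X]
    {ψ : Submodule R S → X} {L : X} :
    FolnerTendsto F ψ L ↔ Filter.Tendsto ψ H.folner (𝓝 L) := Iff.rfl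

theorem eventually_invariant (H : IsAmenableNormal rk F U) {V : Submodule R S} (hV : V ∈ F)
    {δ : ℝ} (hδ : 0 < δ) : ∀ᶠ W in H.folner, W ∈ nonzeroPart F ∧ Invariant V δ W :=
  ⟨V, hV, δ, hδ, fun _ hW h => ⟨hW, h⟩⟩

theorem eventually_mem (H : IsAmenableNormal rk F U) : ∀ᶠ W in H.folner, W ∈ nonzeroPart F :=
  (H.eventually_invariant H.bot_mem one_pos).mono fun _ h => h.1

/-- Invariance under a finite set of generators in `U` implies invariance. -/
theorem exists_finite_invariant (H : IsAmenableNormal rk F U) {V : Submodule R S} (hV : V ∈ F) :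
    ∃ s : Set S, s.Finite ∧ ∀ W ∈ F, ∀ δ, SetInvariant F s δ W → Invariant V δ W := by
  obtain ⟨g, hg, hVg⟩ := H.exists_basis hV
  refine ⟨Set.range g, Set.finite_range g, fun W hW δ ⟨W', hW', hle, hmul, hdim⟩ => ?_⟩
  refine le_trans ?_ hdim
  have h : W ⊔ mulSub W V ≤ W' := by
    refine sup_le hle ?_
    rw [hVg, ← Submodule.span_range_eq_iSup]
    exact H.mulSub_span_le hW hmul
  exact_mod_cast H.freeDim_mono (H.system.sup_mem W hW _ (H.mulSub_mem hW hV)) hW' h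

theorem folner_neBot (H : IsAmenableNormal rk F U) : H.folner.NeBot := by
  refine ⟨fun h => ?_⟩
  have h0 : (∅ : Set (Submodule R S)) ∈ H.folner := by
    rw [h]
    trivial
  obtain ⟨V, hV, δ, hδ, hV'⟩ := h0
  obtain ⟨s, hs, hinv⟩ := H.exists_finite_invariant hV
  obtain ⟨W, hW, hWs⟩ := H.amenable s hs δ hδ
  exact hV' W hW (hinv W hW.1 δ hWs)

theorem map_val_le_folner (H : IsAmenableNormal rk F U) {ω : Ultrafilter (nonzeroPart F)}
    (hω : NonPrincipal F ω) :
    Filter.map (Subtype.val : nonzeroPart F → Submodule R S) ω ≤ H.folner := by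
  rintro s ⟨V, hV, δ, hδ, h⟩
  obtain ⟨t, ht, hinv⟩ := H.exists_finite_invariant hV
  have hsub : {W : nonzeroPart F | SetInvariant F t δ (W : Submodule R S)} ⊆
      Subtype.val ⁻¹' s := fun W hW => h W W.2 (hinv W W.2.1 δ hW)
  exact Filter.mem_map.2 (Filter.mem_of_superset (hω t ht δ hδ) hsub)

/-! ### The key estimate -/

/-- A submodular function that grows by at most `l` times the dimension along each of the
submodules `T i` grows by at most `l` times the dimension along their sum. No disjointness is
needed: the overlap of `T i` with the previous ones is accounted for by submodularity. -/
theorem le_mul_freeDim_iSup (H : IsAmenableNormal rk F U) {D : Submodule R S → ℝ} (hD0 : D ⊥ ≤ 0)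
    (hD : ∀ V ∈ F, ∀ W ∈ F, D (V ⊔ W) + D (V ⊓ W) ≤ D V + D W) {l : ℝ} {n : ℕ}
    {T : Fin n → Submodule R S} (hT : ∀ i, T i ∈ F)
    (h : ∀ i, ∀ C ∈ F, C ≤ T i → D (T i) - D C ≤ l * (freeDim R (T i) - freeDim R C)) :
    D (⨆ i, T i) ≤ l * freeDim R (⨆ i, T i : Submodule R S) := by
  have key : ∀ s : Finset (Fin n), s.sup T ∈ F ∧
      D (s.sup T) ≤ l * freeDim R (s.sup T : Submodule R S) := by
    intro s
    induction s using Finset.cons_induction with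
    | empty => exact ⟨H.bot_mem, by
        rw [Finset.sup_empty, H.freeDim_bot]
        simpa using hD0⟩
    | cons a s ha ih =>
      rw [Finset.sup_cons]
      refine ⟨H.system.sup_mem _ (hT a) _ ih.1, ?_⟩
      have h1 := hD _ (hT a) _ ih.1
      have h2 := h a _ (H.system.inf_mem _ (hT a) _ ih.1) inf_le_left
      have h3 := H.freeDim_sup_add_inf (hT a) ih.1
      have h4 : (freeDim R (T a ⊔ s.sup T : Submodule R S) : ℝ) =
          freeDim R (T a) + freeDim R (s.sup T : Submodule R S) -
            freeDim R (T a ⊓ s.sup T : Submodule R S) := by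
        rw [eq_sub_iff_add_eq]
        exact_mod_cast h3
      rw [h4]
      linarith [ih.2]
  rw [← Finset.sup_univ_eq_iSup]
  exact (key Finset.univ).2

/-- Among the `A ∈ F` for which `A M` has density less than `l`, one of least dimension has no
nonzero smaller submodules of that kind. -/
theorem exists_minimal (H : IsAmenableNormal rk F U) (P M : Submodule R N) {l : ℝ≥0}
    (h : ∃ A ∈ nonzeroPart F, relDim rk P (mulSub A M) < l * freeDim R A) :
    ∃ A ∈ nonzeroPart F, relDim rk P (mulSub A M) < l * freeDim R A ∧
      ∀ C ∈ F, freeDim R C < freeDim R A → l * freeDim R C ≤ relDim rk P (mulSub C M) := by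
  classical
  have hex : ∃ n, ∃ A ∈ nonzeroPart F, freeDim R A = n ∧
      relDim rk P (mulSub A M) < l * freeDim R A := by
    obtain ⟨A, hA, hlt⟩ := h
    exact ⟨_, A, hA, rfl, hlt⟩
  obtain ⟨A, hA, hn, hlt⟩ := Nat.find_spec hex
  refine ⟨A, hA, hlt, fun C hC hCA => ?_⟩
  rcases eq_or_ne C ⊥ with rfl | hC0
  · simp [H.freeDim_bot]
  · rw [hn] at hCA
    by_contra hcon
    exact Nat.find_min hex hCA ⟨C, ⟨hC, hC0⟩, rfl, not_le.1 hcon⟩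

/-- If `A M` has relative dimension less than `l dim A` modulo `P` for one single `A ∈ F`, then
`W M` has relative dimension at most about `l dim W` modulo `W Q` for all sufficiently invariant
`W`, where `Q` consists of finitely many elements of `P`. One may take `A` of least dimension.
Then submodules of `A` have density at least `l`, so that every translate of `A`, added to a
submodule of `S`, increases the dimension by at most `l` times the increase of the rank. As
`W A` is a sum of such translates and differs little from `W`, this gives the bound. -/
theorem exists_eventually_relDim_le (H : IsAmenableNormal rk F U) (P : Submodule S N)
    {M : Submodule R N} (hM : M.FG) {l : ℝ≥0}
    (h : ∃ A ∈ nonzeroPart F, relDim rk (P.restrictScalars R) (mulSub A M) < l * freeDim R A) :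
    ∃ Q : Submodule R N, Q.FG ∧ Q ≤ P.restrictScalars R ∧ ∀ ε : ℝ≥0, 0 < ε →
      ∀ᶠ W in H.folner, relDim rk (mulSub W Q) (mulSub W M) ≤ (l + ε) * freeDim R W := by
  obtain ⟨A, hA, hlt, hmin⟩ := H.exists_minimal _ M h
  have hAM := H.mulSub_fg hA.1 hM
  obtain ⟨Q, hQ, hQP, hQA⟩ := H.sys.approx (P.restrictScalars R) (mulSub A M) hAM _ hlt
  have hQA' : relDim rk Q (mulSub A M) ≤ l * freeDim R A := by
    have h1 := hQA Q hQ le_rfl hQP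
    rw [← H.sys.quot_add hAM hQ] at h1
    exact (ENNReal.add_le_add_iff_right (H.sys.lt_top hQ).ne).1 h1
  refine ⟨Q, hQ, hQP, fun ε hε => ?_⟩
  set K : ℝ := (bivariantOf rk N M).toReal with hK
  have hK0 : 0 ≤ K := ENNReal.toReal_nonneg
  have hl0 : (0 : ℝ) ≤ l := l.2
  -- the error for `(A, δ)`-invariant `W` is `(l + K) δ dim W`
  set δ : ℝ := ε / (l + K + 1) with hδ
  have hδ0 : 0 < δ := div_pos (by exact_mod_cast hε) (by positivity)
  have hδε : (l + K) * δ ≤ ε := by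
    rw [hδ, ← mul_div_assoc, div_le_iff₀ (by positivity), mul_comm]
    exact mul_le_mul_of_nonneg_left (by linarith) ε.2
  filter_upwards [H.eventually_invariant hA.1 hδ0] with W hW
  obtain ⟨hW, hinv⟩ := hW
  have hWQP : mulSub W Q ≤ P.restrictScalars R :=
    mulSub_le.2 fun w _ y hy => P.smul_mem w (hQP hy)
  let D : Submodule R S → ℝ := fun V => (relDim rk (mulSub W Q) (mulSub V M)).toReal
  have hfin : ∀ V ∈ F, relDim rk (mulSub W Q) (mulSub V M) ≠ ⊤ := fun V hV =>
    H.relDim_ne_top _ (H.mulSub_fg hV hM)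
  have hD0 : D ⊥ ≤ 0 := by
    simp [D, relDim, H.sys.bot]
  have hD : ∀ V ∈ F, ∀ W ∈ F, D (V ⊔ W) + D (V ⊓ W) ≤ D V + D W := by
    intro V hV V' hV'
    simp only [D]
    rw [← ENNReal.toReal_add (hfin _ (H.system.sup_mem V hV V' hV'))
      (hfin _ (H.system.inf_mem V hV V' hV')), ← ENNReal.toReal_add (hfin V hV) (hfin V' hV')]
    exact ENNReal.toReal_mono (ENNReal.add_ne_top.2 ⟨hfin V hV, hfin V' hV'⟩)
      (H.relDim_submodular _ hM hV hV')
  obtain ⟨g, hg, hWg⟩ := H.exists_basis hW.1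
  have hgW : ∀ i, g i ∈ W := fun i => by
    rw [hWg]
    exact Submodule.mem_iSup_of_mem i (Submodule.mem_span_singleton_self _)
  have hTF : ∀ i, translate (g i) A ∈ F := fun i => H.translate_mem (hg i) hA.1
  have hT : ∀ i, ∀ C ∈ F, C ≤ translate (g i) A → D (translate (g i) A) - D C ≤
      l * (freeDim R (translate (g i) A) - freeDim R C) := by
    intro i C hC hCT
    rcases hCT.eq_or_lt with rfl | hlt'
    · simp
    · have hdimA := H.freeDim_translate (hg i) hA.1
      have h1 : D (translate (g i) A) ≤ l * freeDim R A := by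
        have h2 : relDim rk (mulSub W Q) (mulSub (translate (g i) A) M) ≤ l * freeDim R A := by
          refine (H.relDim_mono _ (mulSub_translate_le _ _ _)).trans (le_trans ?_ hQA')
          exact H.dim_translate_le (hg i) hAM (translate_le_mulSub (hgW i) Q)
        have h3 := ENNReal.toReal_mono (by finiteness) h2
        simpa using h3
      -- `C` is smaller than `A`, so minimality of `A` bounds the dimension of `C M` from below
      have h4 : l * freeDim R C ≤ D C := by
        have h5 := (hmin C hC (hdimA ▸ H.freeDim_lt hC (hTF i) hlt')).trans
          (H.relDim_anti hWQP _)
        have h6 := ENNReal.toReal_mono (hfin C hC) h5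
        simpa using h6
      rw [hdimA, mul_sub]
      linarith
  have hE : mulSub W A = ⨆ i, translate (g i) A := by
    rw [← mulSub_iSup_span, ← hWg]
  have hEF := H.mulSub_mem hW.1 hA.1
  have h1 : D (mulSub W A) ≤ l * freeDim R (mulSub W A) := by
    rw [hE]
    exact H.le_mul_freeDim_iSup hD0 hD hTF hT
  have hF' := H.system.sup_mem W hW.1 _ hEF
  have h2 := H.freeDim_le_mulSub hW.1 hA
  have h3 := H.freeDim_mono hEF hF' (le_sup_right : _ ≤ W ⊔ mulSub W A)
  have h4 : D W ≤ D (mulSub W A) +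
      (freeDim R (W ⊔ mulSub W A : Submodule R S) - freeDim R (mulSub W A)) * K := by
    have h5 := (H.relDim_mono (mulSub W Q) (mulSub_mono (le_sup_left : W ≤ W ⊔ mulSub W A)
      (le_refl M))).trans (H.relDim_mulSub_le_add (mulSub W Q) hM hEF hF' le_sup_right)
    have hKtop := (H.sys.lt_top hM).ne
    have h6 := ENNReal.toReal_mono (ENNReal.add_ne_top.2 ⟨hfin _ hEF,
      ENNReal.mul_ne_top (by finiteness) hKtop⟩) h5
    rw [ENNReal.toReal_add (hfin _ hEF) (ENNReal.mul_ne_top (by finiteness) hKtop),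
      ENNReal.toReal_mul, ENNReal.toReal_natCast, Nat.cast_sub h3] at h6
    exact h6
  have h2' : (freeDim R W : ℝ) ≤ freeDim R (mulSub W A) := by exact_mod_cast h2
  have h3' : (freeDim R (mulSub W A) : ℝ) ≤ freeDim R (W ⊔ mulSub W A : Submodule R S) := by
    exact_mod_cast h3
  have h7 : D W ≤ (l + ε) * freeDim R W := by
    have hinv' : (freeDim R (W ⊔ mulSub W A : Submodule R S) : ℝ) ≤ (1 + δ) * freeDim R W := hinv
    calc D W ≤ l * freeDim R (mulSub W A) +
          (freeDim R (W ⊔ mulSub W A : Submodule R S) - freeDim R (mulSub W A)) * K := by linarith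
      _ ≤ l * ((1 + δ) * freeDim R W) + ((1 + δ) * freeDim R W - freeDim R W) * K := by
        gcongr
        exact h3'.trans hinv'
      _ = l * freeDim R W + (l + K) * δ * freeDim R W := by ring
      _ ≤ l * freeDim R W + ε * freeDim R W := by gcongr
      _ = _ := by ring
  have h8 : ((l + ε : ℝ≥0∞) * freeDim R W).toReal = (l + ε) * freeDim R W := by
    rw [ENNReal.toReal_mul, ENNReal.toReal_add (by finiteness) (by finiteness)]
    simp
  rw [← ENNReal.toReal_le_toReal (hfin W hW.1) (by finiteness), h8]
  exact h7

end IsAmenableNormal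

/-! ### Convergence of the normalized dimensions -/

/-- The infimum of `dim(W M | N) / dim(W)` over all nonzero `W ∈ F`. It is also the limit, see
`IsAmenableNormal.tendsto_normalizedDim`. -/
def infDim (F : Set (Submodule R S)) (rk : MatrixFun R) (N : Type u) [AddCommGroup N] [Module S N]
    (M : Submodule R N) : ℝ≥0∞ :=
  ⨅ W ∈ nonzeroPart F, normalizedDim rk N M W

theorem exists_span_eq {N₁ : Submodule S N} (h : N₁.FG) :
    ∃ M : Submodule R N, M.FG ∧ Submodule.span S (M : Set N) = N₁ := by
  obtain ⟨n, s, rfl⟩ := Submodule.fg_iff_exists_fin_generating_family.1 h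
  exact ⟨Submodule.span R (Set.range s), Submodule.fg_span (Set.finite_range s),
    Submodule.span_span_of_tower R S _⟩

theorem span_fg {M : Submodule R N} (hM : M.FG) : (Submodule.span S (M : Set N)).FG := by
  obtain ⟨n, s, rfl⟩ := Submodule.fg_iff_exists_fin_generating_family.1 hM
  rw [Submodule.span_span_of_tower R S]
  exact Submodule.fg_span (Set.finite_range s)

theorem span_sup (M M' : Submodule R N) : Submodule.span S ((M ⊔ M' : Submodule R N) : Set N) =
    Submodule.span S (M : Set N) ⊔ Submodule.span S (M' : Set N) := by
  rw [← Submodule.span_union]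
  refine le_antisymm (Submodule.span_le.2 fun x hx => ?_) (Submodule.span_mono ?_)
  · obtain ⟨y, hy, z, hz, rfl⟩ := Submodule.mem_sup.1 hx
    exact Submodule.add_mem _ (Submodule.subset_span (Or.inl hy))
      (Submodule.subset_span (Or.inr hz))
  · exact Set.union_subset (SetLike.coe_subset_coe.2 le_sup_left)
      (SetLike.coe_subset_coe.2 le_sup_right)

theorem span_map {N' : Type u} [AddCommGroup N'] [Module S N'] (f : N →ₗ[S] N')
    (M : Submodule R N) :
    Submodule.span S ((M.map (f.restrictScalars R) : Submodule R N') : Set N') =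
      (Submodule.span S (M : Set N)).map f := by
  rw [Submodule.map_span]
  rfl

namespace IsAmenableNormal

theorem freeDim_ne_zero (H : IsAmenableNormal rk F U) {W : Submodule R S}
    (hW : W ∈ nonzeroPart F) : (freeDim R W : ℝ≥0∞) ≠ 0 := by
  have := H.freeDim_pos hW
  exact_mod_cast this.ne'

theorem normalizedDim_le_iff (H : IsAmenableNormal rk F U) {W : Submodule R S}
    (hW : W ∈ nonzeroPart F) {M : Submodule R N} {c : ℝ≥0∞} :
    normalizedDim rk N M W ≤ c ↔ bivariantOf rk N (mulSub W M) ≤ c * freeDim R W := by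
  rw [normalizedDim, ENNReal.div_le_iff (H.freeDim_ne_zero hW) (ENNReal.natCast_ne_top _)]

theorem normalizedDim_lt_iff (H : IsAmenableNormal rk F U) {W : Submodule R S}
    (hW : W ∈ nonzeroPart F) {M : Submodule R N} {c : ℝ≥0∞} :
    normalizedDim rk N M W < c ↔ bivariantOf rk N (mulSub W M) < c * freeDim R W := by
  rw [normalizedDim, ENNReal.div_lt_iff (Or.inl (H.freeDim_ne_zero hW))
    (Or.inl (ENNReal.natCast_ne_top _))]

theorem tendsto_normalizedDim (H : IsAmenableNormal rk F U) {M : Submodule R N} (hM : M.FG) :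
    Filter.Tendsto (normalizedDim rk N M) H.folner (𝓝 (infDim F rk N M)) := by
  refine tendsto_order.2 ⟨fun a ha => ?_, fun b hb => ?_⟩
  · filter_upwards [H.eventually_mem] with W hW
    exact ha.trans_le (iInf₂_le W hW)
  · -- one `A ∈ F` of density less than `b` bounds the density of all sufficiently invariant `W`
    obtain ⟨A, hA, hAb⟩ : ∃ A ∈ nonzeroPart F, normalizedDim rk N M A < b := by
      simpa [infDim, iInf_lt_iff] using hb
    obtain ⟨c', hc', hcb⟩ := exists_between hAb
    obtain ⟨c, hc, hcc⟩ := exists_between hc'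
    lift c' to ℝ≥0 using (hcb.trans_le le_top).ne
    lift c to ℝ≥0 using (hcc.trans_le le_top).ne
    have hcc' : c < c' := by exact_mod_cast hcc
    rw [H.normalizedDim_lt_iff hA] at hc
    have hbot : (⊥ : Submodule S N).restrictScalars R = ⊥ := rfl
    -- modulo `P = 0` the only possible choice of the relations `Q` is `0`
    obtain ⟨Q, -, hQ, h⟩ := H.exists_eventually_relDim_le (⊥ : Submodule S N) hM (l := c)
      ⟨A, hA, by rwa [hbot, H.relDim_bot]⟩
    rw [hbot, le_bot_iff] at hQ
    subst hQ
    filter_upwards [h (c' - c) (tsub_pos_of_lt hcc'), H.eventually_mem] with W hW hWF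
    refine lt_of_le_of_lt ?_ hcb
    rw [H.normalizedDim_le_iff hWF]
    rw [mulSub_bot_right, H.relDim_bot, ← ENNReal.coe_add, add_tsub_cancel_of_le hcc'.le] at hW
    exact hW

theorem mem_mulSub_of_mem_span (H : IsAmenableNormal rk F U) {M : Submodule R N} {y : N}
    (hy : y ∈ Submodule.span S (M : Set N)) : ∃ V ∈ F, y ∈ mulSub V M := by
  induction hy using Submodule.span_induction with
  | mem x hx =>
    obtain ⟨V, hV, h⟩ := H.system.exhaust (Submodule.span R {1}) (Submodule.fg_span_singleton _)
    refine ⟨V, hV, ?_⟩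
    rw [← one_smul S x]
    exact smul_mem_mulSub (h (Submodule.mem_span_singleton_self _)) hx
  | zero => exact ⟨⊥, H.bot_mem, Submodule.zero_mem _⟩
  | add a b _ _ ha hb =>
    obtain ⟨V, hV, h⟩ := ha
    obtain ⟨V', hV', h'⟩ := hb
    exact ⟨V ⊔ V', H.system.sup_mem V hV V' hV', Submodule.add_mem _
      (mulSub_mono le_sup_left le_rfl h) (mulSub_mono le_sup_right le_rfl h')⟩
  | smul s a _ ha =>
    obtain ⟨V, hV, h⟩ := ha
    obtain ⟨V', hV', h'⟩ := H.system.exhaust (Submodule.span R {s}) (Submodule.fg_span_singleton _)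
    refine ⟨mulSub V' V, H.mulSub_mem hV' hV, ?_⟩
    rw [← H.mulSub_mulSub hV']
    exact smul_mem_mulSub (h' (Submodule.mem_span_singleton_self _)) h

theorem exists_le_mulSub (H : IsAmenableNormal rk F U) {M M' : Submodule R N} (hM' : M'.FG)
    (h : (M' : Set N) ⊆ Submodule.span S (M : Set N)) : ∃ V ∈ F, M' ≤ mulSub V M := by
  induction M', hM' using Submodule.fg_induction with
  | singleton x =>
    obtain ⟨V, hV, hx⟩ := H.mem_mulSub_of_mem_span (h (Submodule.mem_span_singleton_self x))
    exact ⟨V, hV, (Submodule.span_singleton_le_iff_mem _ _).2 hx⟩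
  | sup X Y _ _ h1 h2 =>
    obtain ⟨V, hV, hX⟩ := h1 ((SetLike.coe_subset_coe.2 le_sup_left).trans h)
    obtain ⟨V', hV', hY⟩ := h2 ((SetLike.coe_subset_coe.2 le_sup_right).trans h)
    exact ⟨V ⊔ V', H.system.sup_mem V hV V' hV', sup_le
      (hX.trans (mulSub_mono le_sup_left le_rfl)) (hY.trans (mulSub_mono le_sup_right le_rfl))⟩

/-- The limit does not depend on the generating submodule: if `M' ⊆ V M`, then `W M'` is contained
in `(W + W V) M`, which has almost the same dimension as `W M` if `W` is `V`-invariant. -/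
theorem infDim_le_of_span_le (H : IsAmenableNormal rk F U) {M M' : Submodule R N} (hM : M.FG)
    (hM' : M'.FG) (h : Submodule.span S (M' : Set N) ≤ Submodule.span S (M : Set N)) :
    infDim F rk N M' ≤ infDim F rk N M := by
  obtain ⟨V, hV, hle⟩ := H.exists_le_mulSub hM' (Submodule.subset_span.trans h)
  obtain ⟨K, hK⟩ : ∃ K : ℝ≥0, (K : ℝ≥0∞) = bivariantOf rk N M :=
    ⟨_, ENNReal.coe_toNNReal (H.sys.lt_top hM).ne⟩
  have := H.folner_neBot
  have key : ∀ δ : ℝ≥0, 0 < δ → infDim F rk N M' ≤ infDim F rk N M + δ * K := by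
    intro δ hδ
    refine le_of_tendsto_of_tendsto (H.tendsto_normalizedDim hM')
      ((H.tendsto_normalizedDim hM).add tendsto_const_nhds) ?_
    filter_upwards [H.eventually_invariant hV (δ := δ) (by exact_mod_cast hδ)] with W hW
    obtain ⟨hW, hinv⟩ := hW
    have hWV := H.system.sup_mem W hW.1 _ (H.mulSub_mem hW.1 hV)
    rw [H.normalizedDim_le_iff hW]
    have h1 : mulSub W M' ≤ mulSub (W ⊔ mulSub W V) M := by
      refine (mulSub_mono le_rfl hle).trans ?_
      rw [H.mulSub_mulSub hW.1]
      exact mulSub_mono le_sup_right le_rfl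
    have h2 := H.relDim_mulSub_le_add ⊥ hM hW.1 hWV le_sup_left
    rw [H.relDim_bot, H.relDim_bot] at h2
    have h3 : bivariantOf rk N (mulSub W M) ≤ normalizedDim rk N M W * freeDim R W :=
      (H.normalizedDim_le_iff hW).1 le_rfl
    have h4 : ((freeDim R (W ⊔ mulSub W V : Submodule R S) - freeDim R W : ℕ) : ℝ≥0) ≤
        δ * freeDim R W := by
      rw [← NNReal.coe_le_coe, NNReal.coe_natCast, Nat.cast_sub
        (H.freeDim_mono hW.1 hWV le_sup_left)]
      have : (freeDim R (W ⊔ mulSub W V : Submodule R S) : ℝ) ≤ (1 + δ) * freeDim R W := hinv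
      push_cast
      linarith
    have h5 : ((freeDim R (W ⊔ mulSub W V : Submodule R S) - freeDim R W : ℕ) : ℝ≥0∞) ≤
        δ * freeDim R W := by exact_mod_cast h4
    calc _ ≤ _ := (H.sys.mono h1).trans h2
      _ ≤ normalizedDim rk N M W * freeDim R W + (δ * freeDim R W) * K := by
        rw [hK]
        gcongr
      _ = _ := by ring
  refine ENNReal.le_of_forall_pos_le_add fun ε hε _ => ?_
  refine (key (ε / (K + 1)) (div_pos hε (by positivity))).trans ?_
  gcongr
  rw [← ENNReal.coe_mul, ENNReal.coe_le_coe, div_mul_eq_mul_div]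
  refine div_le_of_le_mul₀ (by positivity) (by positivity) ?_
  gcongr
  exact le_self_add

theorem dimExtFG_eq (H : IsAmenableNormal rk F U) {M : Submodule R N} (hM : M.FG) :
    dimExtFG F rk N (Submodule.span S (M : Set N)) = infDim F rk N M := by
  have hex : ∀ M₁ : Submodule R N, M₁.FG → Submodule.span S (M₁ : Set N) =
      Submodule.span S (M : Set N) → FolnerTendsto F (normalizedDim rk N M₁)
        (infDim F rk N M) := by
    intro M₁ hM₁ h
    rw [H.folnerTendsto_iff]
    have : infDim F rk N M = infDim F rk N M₁ :=
      le_antisymm (H.infDim_le_of_span_le hM₁ hM h.ge) (H.infDim_le_of_span_le hM hM₁ h.le)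
    rw [this]
    exact H.tendsto_normalizedDim hM₁
  have h := Classical.epsilon_spec (p := fun L : ℝ≥0∞ => ∀ M₁ : Submodule R N, M₁.FG →
    Submodule.span S (M₁ : Set N) = Submodule.span S (M : Set N) →
      FolnerTendsto F (normalizedDim rk N M₁) L) ⟨_, hex⟩
  have := H.folner_neBot
  exact tendsto_nhds_unique (H.folnerTendsto_iff.1 (h M hM rfl)) (H.tendsto_normalizedDim hM)

theorem dimExt_span (H : IsAmenableNormal rk F U) {M : Submodule R N} (hM : M.FG) :
    dimExt F rk N (Submodule.span S (M : Set N)) = infDim F rk N M := by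
  refine le_antisymm (iSup_le fun Q => iSup_le fun hQ => iSup_le fun hQM => ?_) ?_
  · obtain ⟨M', hM', rfl⟩ := exists_span_eq (R := R) hQ
    rw [H.dimExtFG_eq hM']
    exact H.infDim_le_of_span_le hM hM' hQM
  · rw [← H.dimExtFG_eq hM]
    exact le_iSup_of_le _ (le_iSup_of_le (span_fg hM) (le_iSup_of_le le_rfl le_rfl))

theorem dimExt_of_fg (H : IsAmenableNormal rk F U) {Q : Submodule S N} (hQ : Q.FG) :
    dimExt F rk N Q = dimExtFG F rk N Q := by
  obtain ⟨M, hM, rfl⟩ := exists_span_eq (R := R) hQ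
  rw [H.dimExt_span hM, H.dimExtFG_eq hM]

/-! ### The axioms for the extended dimension -/

theorem relDim_restrictScalars (H : IsAmenableNormal rk F U) (P : Submodule S N)
    (X : Submodule R N) : relDim rk (P.restrictScalars R) X =
      bivariantOf rk (N ⧸ P) (X.map (P.mkQ.restrictScalars R)) := by
  refine H.sys.quot_eq_map _ P.mkQ_surjective ?_ X
  ext x
  simp

theorem infDim_map_le (H : IsAmenableNormal rk F U) {N' : Type u} [AddCommGroup N'] [Module S N']
    (f : N →ₗ[S] N') (M : Submodule R N) :
    infDim F rk N' (M.map (f.restrictScalars R)) ≤ infDim F rk N M := by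
  refine iInf₂_mono fun W _ => ?_
  rw [normalizedDim, normalizedDim, ← map_mulSub]
  gcongr
  exact H.sys.map_le _ _

/-- Both the limit and the dimension over `R` are infima, so that the infimum over the finitely
generated overmodules commutes with the limit. -/
theorem exists_infDim_lt (H : IsAmenableNormal rk F U) {M : Submodule R N} (hM : M.FG)
    {b : ℝ≥0∞} (hb : infDim F rk N M < b) :
    ∃ Q : Submodule S N, Q.FG ∧ Submodule.span S (M : Set N) ≤ Q ∧
      infDim F rk Q (M.comap (Q.subtype.restrictScalars R)) < b := by
  obtain ⟨A, hA, hAb⟩ : ∃ A ∈ nonzeroPart F, normalizedDim rk N M A < b := by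
    simpa [infDim, iInf_lt_iff] using hb
  rw [H.normalizedDim_lt_iff hA, H.sys.inf _ _ (H.mulSub_fg hA.1 hM)] at hAb
  simp only [iInf_lt_iff] at hAb
  obtain ⟨Y, hY, hle, hlt⟩ := hAb
  let Q := Submodule.span S ((Y ⊔ M : Submodule R N) : Set N)
  have hMQ : M ≤ Q.restrictScalars R := fun x hx =>
    Submodule.subset_span ((le_sup_right : M ≤ Y ⊔ M) hx)
  refine ⟨Q, span_fg (hY.sup hM), Submodule.span_le.2 hMQ, ?_⟩
  refine lt_of_le_of_lt (iInf₂_le A hA) ?_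
  rw [H.normalizedDim_lt_iff hA]
  refine lt_of_le_of_lt ?_ hlt
  let f : Y →ₗ[R] Q := Submodule.inclusion (show Y ≤ Q.restrictScalars R from fun x hx =>
    Submodule.subset_span ((le_sup_left : Y ≤ Y ⊔ M) hx))
  refine le_trans (H.sys.mono ?_) (H.sys.map_le f _)
  refine mulSub_le.2 fun w hw y hy => ?_
  exact ⟨⟨w • (y : N), hle (smul_mem_mulSub hw hy)⟩, smul_mem_mulSub hw hy, rfl⟩

/-- Replacing the submodule `P` of relations by finitely many of its elements does not change the
dimension by much. -/
theorem exists_infDim_sup_le (H : IsAmenableNormal rk F U) (P : Submodule S N) {M : Submodule R N}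
    (hM : M.FG) {t : ℝ≥0∞} (ht : infDim F rk (N ⧸ P) (M.map (P.mkQ.restrictScalars R)) < t) :
    ∃ Q : Submodule R N, Q.FG ∧ Q ≤ P.restrictScalars R ∧ ∀ Q' : Submodule R N, Q'.FG → Q ≤ Q' →
      infDim F rk N (M ⊔ Q') ≤ t + infDim F rk N Q' := by
  obtain ⟨A, hA, hAt⟩ : ∃ A ∈ nonzeroPart F,
      normalizedDim rk (N ⧸ P) (M.map (P.mkQ.restrictScalars R)) A < t := by
    simpa [infDim, iInf_lt_iff] using ht
  obtain ⟨c', hc', hct⟩ := exists_between hAt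
  obtain ⟨c, hc, hcc⟩ := exists_between hc'
  lift c' to ℝ≥0 using (hct.trans_le le_top).ne
  lift c to ℝ≥0 using (hcc.trans_le le_top).ne
  have hcc' : c < c' := by exact_mod_cast hcc
  rw [H.normalizedDim_lt_iff hA, ← map_mulSub, ← H.relDim_restrictScalars] at hc
  obtain ⟨Q, hQ, hQP, h⟩ := H.exists_eventually_relDim_le P hM ⟨A, hA, hc⟩
  refine ⟨Q, hQ, hQP, fun Q' hQ' hQQ' => ?_⟩
  have := H.folner_neBot
  refine le_of_tendsto_of_tendsto (H.tendsto_normalizedDim (hM.sup hQ'))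
    (tendsto_const_nhds.add (H.tendsto_normalizedDim hQ')) ?_
  filter_upwards [h (c' - c) (tsub_pos_of_lt hcc'), H.eventually_mem] with W hW hWF
  rw [← ENNReal.coe_add, add_tsub_cancel_of_le hcc'.le] at hW
  rw [H.normalizedDim_le_iff hWF, mulSub_sup_right, add_mul,
    ← H.sys.quot_add (H.mulSub_fg hWF.1 hM) (H.mulSub_fg hWF.1 hQ')]
  refine add_le_add ?_ ((H.normalizedDim_le_iff hWF).1 le_rfl)
  refine (H.relDim_anti (mulSub_mono le_rfl hQQ') _).trans (hW.trans ?_)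
  gcongr

/-- This holds for each `W ∈ F` separately. -/
theorem infDim_superadd (H : IsAmenableNormal rk F U) (P : Submodule S N) {M Q : Submodule R N}
    (hM : M.FG) (hQ : Q.FG) (hQP : Q ≤ P.restrictScalars R) :
    infDim F rk (N ⧸ P) (M.map (P.mkQ.restrictScalars R)) + infDim F rk N Q ≤
      infDim F rk N (M ⊔ Q) := by
  refine le_iInf₂ fun W hW => ?_
  refine (add_le_add (iInf₂_le W hW) (iInf₂_le W hW)).trans ?_
  rw [normalizedDim, normalizedDim, normalizedDim, ← ENNReal.add_div, ← map_mulSub,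
    ← H.relDim_restrictScalars, mulSub_sup_right]
  gcongr
  exact H.sys.superadd _ _ _ (H.mulSub_fg hW.1 hM) (H.mulSub_fg hW.1 hQ)
    (mulSub_le.2 fun w _ y hy => P.smul_mem w (hQP hy))

theorem infDim_one (H : IsAmenableNormal rk F U) :
    infDim F rk S (Submodule.span R {1}) = 1 := by
  have h : ∀ W ∈ nonzeroPart F, normalizedDim rk S (Submodule.span R {1}) W = 1 := by
    intro W hW
    have h1 : mulSub W (Submodule.span R {(1 : S)}) = W := by
      refine le_antisymm (H.mulSub_span_le hW.1 ?_) fun w hw => ?_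
      · rintro w hw _ rfl
        simpa using hw
      · have := smul_mem_mulSub (N := S) hw (Submodule.mem_span_singleton_self (R := R) (1 : S))
        simpa using this
    rw [normalizedDim, h1, H.dim_eq hW.1]
    exact ENNReal.div_self (H.freeDim_ne_zero hW) (ENNReal.natCast_ne_top _)
  have := H.folner_neBot
  refine tendsto_nhds_unique (H.tendsto_normalizedDim (Submodule.fg_span_singleton _))
    (Filter.Tendsto.congr' ?_ tendsto_const_nhds)
  filter_upwards [H.eventually_mem] with W hW
  exact (h W hW).symm

theorem isRankSystem_dimExt (H : IsAmenableNormal rk F U) : IsRankSystem (dimExt F rk) where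
  map_le_of_fg f P hP := by
    obtain ⟨M, hM, rfl⟩ := exists_span_eq (R := R) hP
    rw [← span_map, H.dimExt_span hM, H.dimExt_span (hM.map _)]
    exact H.infDim_map_le f M
  sup M _ _ P := iSup_congr fun Q => iSup_congr fun hQ => by rw [H.dimExt_of_fg hQ]
  inf N _ _ P hP := by
    obtain ⟨M, hM, rfl⟩ := exists_span_eq (R := R) hP
    have key : ∀ Q : Submodule S N, Submodule.span S (M : Set N) ≤ Q →
        (M.comap (Q.subtype.restrictScalars R)).FG ∧
        (M.comap (Q.subtype.restrictScalars R)).map (Q.subtype.restrictScalars R) = M ∧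
        (Submodule.span S (M : Set N)).submoduleOf Q =
          Submodule.span S (M.comap (Q.subtype.restrictScalars R) : Set Q) := by
      intro Q hQ
      have hinj : Function.Injective (Q.subtype.restrictScalars R) := Q.injective_subtype
      have h1 : (M.comap (Q.subtype.restrictScalars R)).map (Q.subtype.restrictScalars R) = M := by
        rw [Submodule.map_comap_eq, inf_eq_right]
        intro x hx
        exact ⟨⟨x, hQ (Submodule.subset_span hx)⟩, rfl⟩
      refine ⟨Submodule.fg_of_fg_map_injective _ hinj (by rwa [h1]), h1, ?_⟩
      apply Submodule.map_injective_of_injective Q.injective_subtype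
      rw [Submodule.submoduleOf, Submodule.map_comap_subtype, inf_eq_right.2 hQ, ← span_map, h1]
    rw [H.dimExt_span hM]
    refine le_antisymm (le_iInf fun Q => le_iInf fun _ => le_iInf fun hQ => ?_) ?_
    · obtain ⟨h1, h2, h3⟩ := key Q hQ
      rw [h3, H.dimExt_span h1]
      conv_lhs => rw [← h2]
      exact H.infDim_map_le _ _
    · refine le_of_forall_gt fun b hb => ?_
      obtain ⟨Q, hQ, hMQ, hlt⟩ := H.exists_infDim_lt hM hb
      refine lt_of_le_of_lt (iInf_le_of_le Q (iInf_le_of_le hQ (iInf_le _ hMQ))) ?_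
      obtain ⟨h1, h2, h3⟩ := key Q hMQ
      rwa [h3, H.dimExt_span h1]
  one := by
    have h : (⊤ : Submodule S S) =
        Submodule.span S (Submodule.span R {(1 : S)} : Submodule R S) := by
      rw [Submodule.span_span_of_tower, eq_comm, Submodule.eq_top_iff']
      intro x
      exact Submodule.mem_span_singleton.2 ⟨x, by simp⟩
    rw [h, H.dimExt_span (Submodule.fg_span_singleton _), H.infDim_one]
  superadd P X C hX hC hCP := by
    obtain ⟨M, hM, rfl⟩ := exists_span_eq (R := R) hX
    obtain ⟨Q, hQ, rfl⟩ := exists_span_eq (R := R) hC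
    rw [← span_map, ← span_sup, H.dimExt_span (hM.map _), H.dimExt_span hQ,
      H.dimExt_span (hM.sup hQ)]
    exact H.infDim_superadd P hM hQ fun x hx => hCP (Submodule.subset_span hx)
  approx {N} _ _ P X hX t ht := by
    obtain ⟨M, hM, rfl⟩ := exists_span_eq (R := R) hX
    rw [← span_map, H.dimExt_span (hM.map _)] at ht
    obtain ⟨Q, hQ, hQP, h⟩ := H.exists_infDim_sup_le P hM ht
    refine ⟨Submodule.span S (Q : Set N), span_fg hQ, Submodule.span_le.2 hQP,
      fun C hC hQC _ => ?_⟩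
    obtain ⟨Q', hQ', rfl⟩ := exists_span_eq (R := R) hC
    have h1 : Submodule.span S (Q' : Set N) =
        Submodule.span S ((Q ⊔ Q' : Submodule R N) : Set N) := by
      rw [span_sup, sup_eq_right.2 hQC]
    rw [h1, ← span_sup, H.dimExt_span (hM.sup (hQ.sup hQ')), H.dimExt_span (hQ.sup hQ')]
    exact h _ (hQ.sup hQ') le_sup_left

/-! ### The matrix rank function on the extension -/

/-- `rk_W(P)` is the dimension of `Wⁿ P = W M` in `Sᵐ`, where `M` is spanned by the rows of `P`. -/
theorem dim_eq_rk_of_isMatrixOf (H : IsAmenableNormal rk F U) {W : Submodule R S} (hW : W ∈ F)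
    {n m : ℕ} {P : Matrix (Fin n) (Fin m) S} {l p : ℕ} {B : Matrix (Fin l) (Fin p) R}
    (hB : IsMatrixOf F W P B) :
    bivariantOf rk (Fin m → S) (mulSub W (Submodule.span R (Set.range P))) = rk B := by
  obtain ⟨W', hW', hmul, b, b', hbb⟩ := hB
  let X : Submodule R (Fin m → W') :=
    (rowModule B).map (b'.equivFun.symm : (Fin p → R) →ₗ[R] (Fin m → W'))
  have h1 := H.dim_pi hW'.1 m X ((rowModule_fg B).map _)
  rw [H.sys.map_equiv, ← corresponds_bivariantOf H.rank] at h1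
  rw [← h1]
  congr 1
  -- the map `w ↦ w P` on `Wⁿ`
  let f : (Fin n → W) →ₗ[R] (Fin m → S) :=
    { toFun := fun w j => ∑ k, (w k : S) * P k j
      map_add' := fun v w => by
        ext j
        simp [add_mul, Finset.sum_add_distrib]
      map_smul' := fun r w => by
        ext j
        simp [Finset.smul_sum, Subring.smul_def, mul_assoc] }
  have hf : LinearMap.range f = mulSub W (Submodule.span R (Set.range P)) := by
    refine le_antisymm ?_ (H.mulSub_span_le hW ?_)
    · rintro _ ⟨w, rfl⟩
      have : f w = ∑ k, (w k : S) • P k := by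
        ext j
        simp [f]
      rw [this]
      exact Submodule.sum_mem _ fun k _ =>
        smul_mem_mulSub (w k).2 (Submodule.subset_span ⟨k, rfl⟩)
    · rintro w hw _ ⟨k, rfl⟩
      refine ⟨Pi.single k ⟨w, hw⟩, ?_⟩
      ext j
      simp only [f, LinearMap.coe_mk, AddHom.coe_mk]
      rw [Finset.sum_eq_single k]
      · simp
      · intro i _ hi
        simp [hi]
      · simp
  have hfb : ∀ i, f (b i) = W'.subtype.compLeft (Fin m) (b'.equivFun.symm (B i)) := by
    intro i
    ext j
    rw [Module.Basis.equivFun_symm_apply]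
    simp only [f, LinearMap.coe_mk, AddHom.coe_mk, hbb]
    simp [Subring.smul_def]
  have hX : X = Submodule.span R (Set.range fun i => b'.equivFun.symm (B i)) := by
    simp only [X]
    rw [rowModule_eq_span, Submodule.map_span]
    congr 1
    exact (Set.range_comp (b'.equivFun.symm : (Fin p → R) → (Fin m → W')) B).symm
  rw [← hf, hX, Submodule.map_span, ← Set.range_comp, ← Submodule.map_top, ← b.span_eq,
    Submodule.map_span, ← Set.range_comp]
  congr 2
  exact funext hfb

theorem exists_isMatrixOf (H : IsAmenableNormal rk F U) {W : Submodule R S}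
    (hW : W ∈ nonzeroPart F) {n m : ℕ} (P : Matrix (Fin n) (Fin m) S) :
    ∃ (l p : ℕ) (B : Matrix (Fin l) (Fin p) R), IsMatrixOf F W P B := by
  let X : Submodule R S := ⨆ i : Fin n, ⨆ j : Fin m, mulSub W (Submodule.span R {P i j})
  have hX : X.FG := Submodule.fg_iSup _ fun i => Submodule.fg_iSup _ fun j =>
    H.mulSub_fg (N := S) hW.1 (Submodule.fg_span_singleton _)
  obtain ⟨W', hW', hle⟩ := H.system.exhaust (W ⊔ X) ((H.fg hW.1).sup hX)
  have hW'0 : W' ≠ ⊥ := fun h => hW.2 (le_bot_iff.1 (h ▸ le_sup_left.trans hle))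
  have hmul : ∀ i j, ∀ w ∈ W, w * P i j ∈ W' := fun i j w hw => by
    refine hle ((le_sup_right : X ≤ W ⊔ X) (Submodule.mem_iSup_of_mem i
      (Submodule.mem_iSup_of_mem j ?_)))
    exact smul_mem_mulSub (N := S) hw (Submodule.mem_span_singleton_self _)
  obtain ⟨k, b₀, -⟩ := H.normal.basis W hW.1
  obtain ⟨k', b₀', -⟩ := H.normal.basis W' hW'
  let b := (Pi.basis fun _ : Fin n => b₀).reindex (Fintype.equivFin _)
  let b' := (Pi.basis fun _ : Fin m => b₀').reindex (Fintype.equivFin _)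
  let v : Fin (Fintype.card (Σ _ : Fin n, Fin k)) → Fin m → W' := fun i j =>
    ⟨∑ q, (b i q : S) * P q j, W'.sum_mem fun q _ => hmul q j _ (b i q).2⟩
  refine ⟨_, _, Matrix.of fun i => b'.equivFun (v i), W', ⟨hW', hW'0⟩, hmul, b, b',
    fun i j => ?_⟩
  have h1 := congrFun (b'.sum_equivFun (v i)) j
  have h2 := congrArg (Subtype.val) h1
  simp only [Finset.sum_apply, Pi.smul_apply, AddSubmonoidClass.coe_finsetSum, Submodule.coe_smul,
    Subring.smul_def, smul_eq_mul] at h2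
  exact h2.symm

theorem rkOn_eq (H : IsAmenableNormal rk F U) {W : Submodule R S} (hW : W ∈ nonzeroPart F)
    {n m : ℕ} (P : Matrix (Fin n) (Fin m) S) : (rkOn F rk W P : ℝ≥0∞) =
      bivariantOf rk (Fin m → S) (mulSub W (Submodule.span R (Set.range P))) := by
  obtain ⟨l, p, B, hB⟩ := H.exists_isMatrixOf hW P
  have hset : {r : ℝ≥0 | ∃ (l p : ℕ) (B : Matrix (Fin l) (Fin p) R),
      IsMatrixOf F W P B ∧ r = rk B} = {rk B} := by
    ext r
    rw [Set.mem_singleton_iff]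
    constructor
    · rintro ⟨l', p', B', hB', rfl⟩
      rw [← ENNReal.coe_inj, ← H.dim_eq_rk_of_isMatrixOf hW.1 hB',
        ← H.dim_eq_rk_of_isMatrixOf hW.1 hB]
    · rintro rfl
      exact ⟨l, p, B, hB, rfl⟩
  rw [rkOn, hset, csInf_singleton, H.dim_eq_rk_of_isMatrixOf hW.1 hB]

theorem rkOn_div_eq (H : IsAmenableNormal rk F U) {W : Submodule R S} (hW : W ∈ nonzeroPart F)
    {n m : ℕ} (P : Matrix (Fin n) (Fin m) S) :
    (rkOn F rk W P : ℝ≥0∞) / (freeDim R W : ℝ≥0∞) =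
      normalizedDim rk (Fin m → S) (Submodule.span R (Set.range P)) W := by
  rw [H.rkOn_eq hW, normalizedDim]

theorem dimExt_rowModule (H : IsAmenableNormal rk F U) {n m : ℕ} (P : Matrix (Fin n) (Fin m) S) :
    dimExt F rk (Fin m → S) (rowModule P) =
      infDim F rk (Fin m → S) (Submodule.span R (Set.range P)) := by
  rw [rowModule_eq_span, ← Submodule.span_span_of_tower R S,
    H.dimExt_span (Submodule.fg_span (Set.finite_range P))]

theorem tendsto_rkOn (H : IsAmenableNormal rk F U) {n m : ℕ} (P : Matrix (Fin n) (Fin m) S) :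
    Filter.Tendsto (fun W => (rkOn F rk W P : ℝ≥0∞) / (freeDim R W : ℝ≥0∞)) H.folner
      (𝓝 (dimExt F rk (Fin m → S) (rowModule P))) := by
  rw [H.dimExt_rowModule]
  refine Filter.Tendsto.congr' ?_
    (H.tendsto_normalizedDim (Submodule.fg_span (Set.finite_range P)))
  filter_upwards [H.eventually_mem] with W hW
  exact (H.rkOn_div_eq hW P).symm

theorem corresponds_rkExt (H : IsAmenableNormal rk F U) {ω : Ultrafilter (nonzeroPart F)}
    (hω : NonPrincipal F ω) : Corresponds (dimExt F rk) (rkExt F rk ω) := by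
  intro n m P
  have hfin : dimExt F rk (Fin m → S) (rowModule P) ≠ ⊤ :=
    (H.isRankSystem_dimExt.lt_top (rowModule_fg P)).ne
  obtain ⟨L, hL⟩ : ∃ L : ℝ≥0, (L : ℝ≥0∞) = dimExt F rk (Fin m → S) (rowModule P) :=
    ⟨_, ENNReal.coe_toNNReal hfin⟩
  have h1 := (H.tendsto_rkOn P).comp (Filter.tendsto_iff_comap.2
    (Filter.map_le_iff_le_comap.1 (H.map_val_le_folner hω)))
  rw [← hL] at h1 ⊢
  have h2 : Filter.Tendsto (fun W : nonzeroPart F => rkOn F rk (W : Submodule R S) P /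
      (freeDim R (W : Submodule R S) : ℝ≥0)) ω (𝓝 L) := by
    rw [← ENNReal.tendsto_coe]
    refine h1.congr fun W => ?_
    have h3 : (freeDim R (W : Submodule R S) : ℝ≥0) ≠ 0 := by
      exact_mod_cast (H.freeDim_pos W.2).ne'
    rw [ENNReal.coe_div h3]
    simp
  rw [rkExt, h2.limUnder_eq]

end IsAmenableNormal

end AmenableExtension

end SylvesterRank

end

theorem theorem8p4 {S : Type u} [Ring S] (R : Subring S)
    (rk : MatrixFun R) (hrk : IsSylvesterMatrixRank rk)
    (F : Set (Submodule R S)) (U : Submonoid S)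
    (hF : IsFiniteApproximationSystem F) (hamenable : IsRightAmenable F)
    (hnormal : IsNormalSystem F U) (hpreserve : PreservesRank U rk)
    (hquasi : WeakQuasitiling F U) :
    -- the limits that define `dim_F` exist and do not depend on the generating submodule
    (∀ (N : Type u) [AddCommGroup N] [Module S N] (N₁ : Submodule S N) (M₁ : Submodule R N),
      M₁.FG → Submodule.span S (M₁ : Set N) = N₁ →
        FolnerTendsto F (normalizedDim rk N M₁) (dimExt F rk N N₁)) ∧
    -- `dim_F` is a bivariant Sylvester module rank function for `S`
    IsBivariantRank (dimExt F rk) ∧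
    -- it is the one that corresponds to the Sylvester matrix rank function `rk_F`
    (∀ ω : Ultrafilter (nonzeroPart F), NonPrincipal F ω →
      IsSylvesterMatrixRank (rkExt F rk ω) ∧
      Corresponds (dimExt F rk) (rkExt F rk ω) ∧
      ∀ d : BivariantFun S, IsBivariantRank d → Corresponds d (rkExt F rk ω) →
        d = dimExt F rk) ∧
    -- `rk_F` is also the limit of `rk_W / dim(W)` as `W` becomes more and more right invariant
    (∀ (n m : ℕ) (P : Matrix (Fin n) (Fin m) S),
      FolnerTendsto F
        (fun W => (rkOn F rk W P : ℝ≥0∞) / (freeDim R W : ℝ≥0∞))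
        (dimExt F rk (Fin m → S) (rowModule P))) := by
  have H : IsAmenableNormal rk F U := ⟨hrk, hF, hamenable, hnormal, hpreserve⟩
  refine ⟨?_, H.isRankSystem_dimExt.isBivariantRank, fun ω hω => ?_, fun n m P => ?_⟩
  · rintro N _ _ N₁ M₁ hM₁ rfl
    rw [H.dimExt_span hM₁]
    exact H.tendsto_normalizedDim hM₁
  · have hc := H.corresponds_rkExt hω
    exact ⟨H.isRankSystem_dimExt.isSylvesterMatrixRank hc, hc, fun d hd hdc =>
      hd.eq_of_corresponds H.isRankSystem_dimExt.isBivariantRank hdc hc⟩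
  · exact H.tendsto_rkOn P
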